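/- **Setting.** Let $A\in\mathbb C^{n\times n}$ have all its eigenvalues in the open unit disc, let $B\in\mathbb C^{n\times 1}$ be such that $(A,B)$ is reachable (i.e. $B,AB,\dots,A^{n-1}B$ span $\mathbb C^n$), and put $G(z)=(zI-A)^{-1}B$. Let $\Psi$ be a continuous, strictly positive function on the unit circle $\mathbb T$. All integrals are over $\mathbb T$ with respect to the normalized Lebesgue measure $d\vartheta/2\pi$. Let $\mathcal L_\circ$ be the set of Hermitian matrices $\Lambda$ that satisfy the dual conditions $$G^*\Lambda G>0\ \text{ on }\mathbb T,\qquad \int G\,\frac{\Psi}{G^*\Lambda G}\,G^*=I,$$ and let $\mathcal L_{\circ+}$ be the set of positive definite $\Lambda\in\mathcal L_\circ$. For a real continuous function $\Phi$ on $\mathbb T$ let $\Gamma(\Phi)=\int G\Phi G^*$, and let $(\mathrm{Range}\,\Gamma)^\perp$ be the set of Hermitian matrices $X$ with $\mathrm{tr}(X\,\Gamma(\Phi))=0$ for all such $\Phi$. For positive semidefinite $\Lambda$ let $$\Theta(\Lambda)=\int \Lambda^{1/2}G\,\frac{\Psi}{G^*\Lambda G}\,G^*\Lambda^{1/2}.$$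 **Theorem.** The set $\mathcal L_{\circ+}$ is locally asymptotically stable for $\Theta$. More precisely, let $\Lambda_\circ\in\mathcal L_{\circ+}$, and let $\|\cdot\|$ be the Frobenius norm. Then $\mathcal L_\circ$ is the affine space $\{\Lambda_\circ+X:\ X\in(\mathrm{Range}\,\Gamma)^\perp\}$, of which $\mathcal L_{\circ+}$ is the positive definite part, and: 1. (stability) for every $\varepsilon>0$ there is a $\delta>0$ such that every sequence of iterates $\Lambda_{k+1}=\Theta(\Lambda_k)$, $k\ge 0$, with $\Lambda_0$ Hermitian and $\|\Lambda_0-\Lambda_\circ\|<\delta$ satisfies $\|\Lambda_k-\Lambda_\circ\|<\varepsilon$ for all $k\ge 0$; 2. (exponential convergence) there are constants $\delta>0$, $\kappa>0$ and $0<\beta<1$ such that, for every sequence of iterates $\Lambda_{k+1}=\Theta(\Lambda_k)$, $k\ge 0$, with $\Lambda_0$ Hermitian and $\|\Lambda_0-\Lambda_\circ\|<\delta$, all $\Lambda_k$ are positive definite and there is a $\bar\Lambda\in\mathcal L_{\circ+}$ with $\|\Lambda_k-\bar\Lambda\|\le\kappa\beta^k$ for all $k\ge 0$. -/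

import Mathlib

open scoped MatrixOrder ComplexOrder

namespace SpectralApprox

noncomputable section

/-- All eigenvalues of `A` lie in the open unit disc. -/
def IsStabilityMatrix {n : ℕ} (A : Matrix (Fin n) (Fin n) ℂ) : Prop :=
  ∀ μ ∈ spectrum ℂ A, ‖μ‖ < 1

/-- Reachability of `(A, B)`: the columns `B, A B, …, A ^ (n - 1) B` span `ℂⁿ`. -/
def IsReachablePair {n : ℕ} (A : Matrix (Fin n) (Fin n) ℂ) (B : Fin n → ℂ) : Prop :=
  Submodule.span ℂ (Set.range fun k : Fin n => (A ^ (k : ℕ)).mulVec B) = ⊤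

/-- The transfer function `G(z) = (z I - A)⁻¹ B` (a column vector) on the unit circle. -/
def transfer {n : ℕ} (A : Matrix (Fin n) (Fin n) ℂ) (B : Fin n → ℂ) (z : Circle) : Fin n → ℂ :=
  ((z : ℂ) • (1 : Matrix (Fin n) (Fin n) ℂ) - A)⁻¹.mulVec B

/-- The scalar `G(z)* Λ G(z)`. -/
def quadForm {n : ℕ} (A : Matrix (Fin n) (Fin n) ℂ) (B : Fin n → ℂ)
    (Λ : Matrix (Fin n) (Fin n) ℂ) (z : Circle) : ℂ :=
  dotProduct (star (transfer A B z)) (Λ.mulVec (transfer A B z))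

/-- The matrix `∫ G φ G*`, taken entrywise, with respect to the normalized Lebesgue
measure `dϑ / 2π` on the unit circle. -/
def moment {n : ℕ} (A : Matrix (Fin n) (Fin n) ℂ) (B : Fin n → ℂ) (φ : Circle → ℂ) :
    Matrix (Fin n) (Fin n) ℂ :=
  Matrix.of fun i j => (2 * (Real.pi : ℂ))⁻¹ * ∫ ϑ in (-Real.pi)..Real.pi,
    transfer A B (Circle.exp ϑ) i * φ (Circle.exp ϑ) * star (transfer A B (Circle.exp ϑ) j)

/-- The linear operator `Γ : Φ ↦ ∫ G Φ G*` on real-valued continuous functions. -/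
def Gam {n : ℕ} (A : Matrix (Fin n) (Fin n) ℂ) (B : Fin n → ℂ) (Φ : C(Circle, ℝ)) :
    Matrix (Fin n) (Fin n) ℂ :=
  moment A B fun z => (Φ z : ℂ)

/-- The orthogonal complement of `Range Γ` in the Hermitian matrices, for the inner product
`⟨P, Q⟩ = tr (P Q)`. -/
def rangeGamPerp {n : ℕ} (A : Matrix (Fin n) (Fin n) ℂ) (B : Fin n → ℂ) :
    Set (Matrix (Fin n) (Fin n) ℂ) :=
  {X | X.IsHermitian ∧ ∀ Φ : C(Circle, ℝ), (X * Gam A B Φ).trace = 0}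

/-- The set `𝓛∘` of Hermitian solutions of the dual conditions: `G* Λ G > 0` on the circle
and `∫ G (Ψ / (G* Λ G)) G* = I`. -/
def dualSolutions {n : ℕ} (A : Matrix (Fin n) (Fin n) ℂ) (B : Fin n → ℂ) (Ψ : C(Circle, ℝ)) :
    Set (Matrix (Fin n) (Fin n) ℂ) :=
  {Λ | Λ.IsHermitian ∧ (∀ z : Circle, 0 < quadForm A B Λ z) ∧
    moment A B (fun z => (Ψ z : ℂ) / quadForm A B Λ z) = 1}

/-- The set `𝓛∘₊` of positive definite elements of `𝓛∘`. -/
def posDualSolutions {n : ℕ} (A : Matrix (Fin n) (Fin n) ℂ) (B : Fin n → ℂ)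
    (Ψ : C(Circle, ℝ)) : Set (Matrix (Fin n) (Fin n) ℂ) :=
  {Λ | Λ ∈ dualSolutions A B Ψ ∧ Λ.PosDef}

/-- The map `Θ(Λ) = ∫ Λ^{1/2} G (Ψ / (G* Λ G)) G* Λ^{1/2}`. The constant factors `Λ^{1/2}`,
the positive semidefinite square root of `Λ ≥ 0`, are taken out of the integral. -/
def Theta {n : ℕ} (A : Matrix (Fin n) (Fin n) ℂ) (B : Fin n → ℂ) (Ψ : C(Circle, ℝ))
    (Λ : Matrix (Fin n) (Fin n) ℂ) : Matrix (Fin n) (Fin n) ℂ :=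
  CFC.sqrt Λ * moment A B (fun z => (Ψ z : ℂ) / quadForm A B Λ z) * CFC.sqrt Λ

end

end SpectralApprox

open scoped Matrix.Norms.Frobenius

namespace SpectralApprox

/-- `Λ` is a trajectory of the iteration `Λ_{k+1} = Θ(Λ_k)` that starts at a Hermitian matrix
at (Frobenius) distance less than `δ` from `Λ₀`. -/
def IsTrajectoryNear {n : ℕ} (A : Matrix (Fin n) (Fin n) ℂ) (B : Fin n → ℂ) (Ψ : C(Circle, ℝ))
    (Λ₀ : Matrix (Fin n) (Fin n) ℂ) (δ : ℝ) (Λ : ℕ → Matrix (Fin n) (Fin n) ℂ) : Prop :=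
  (Λ 0).IsHermitian ∧ ‖Λ 0 - Λ₀‖ < δ ∧ ∀ k, Λ (k + 1) = Theta A B Ψ (Λ k)

end SpectralApprox

/-! Let `Λ₀` solve the dual conditions and put a = G*ΛG, b = G*Λ₀G. Since Ψ/a = Ψ/b - Ψ(a - b)/(ab)
and the moment of Ψ/b is I, the identity Θ(Λ) = Λ - P_Λ(Λ - Λ₀) is exact, with P_Λ X = Λ^{1/2} (∫ G
Ψ/(ab) (G*XG) G*) Λ^{1/2} (`Theta_eq_sub_momentOp`). No derivative of Θ is needed: it suffices to
understand P = P_{Λ₀} and to bound P_Λ - P.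

With S = Λ₀^{1/2}, P is symmetric and nonnegative for the inner product tr(X* S⁻¹ Y S⁻¹). Its
eigenvalues are at most 1 by a maximum principle (`eigenvalue_momentOp_le_one`). Its kernel is {X :
G*XG = 0 on the circle}, whose Hermitian part is (Range Γ)^⊥, the direction of the affine set of
dual solutions. Hence I - P is a strict contraction transversally to the kernel.

The fixed points are not isolated, so an error o(‖Λ - Λ₀‖) would not suffice. But every P_Λ sees X
only through G*XG and so kills ker P; with the Lipschitz bound on Λ ↦ P_Λ, the error is at most C‖Λ
- Λ₀‖ times the distance of Λ - Λ₀ to ker P. The transversal component then decays geometrically,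
the steps are summable, and the iterates converge to a nearby point of Λ₀ + ker P
(`exp_convergence_of_isSymmetric`). -/

namespace SpectralApprox

open Filter Topology

/-! ### Iterations near a linear space of fixed points -/

section Abstract

variable {E : Type*} [NormedAddCommGroup E] [InnerProductSpace ℂ E] [FiniteDimensional ℂ E]

/-- A symmetric operator `P` with eigenvalues in `[0, 1]` makes `1 - P` a strict contraction on the
orthogonal complement of `ker P`. -/
theorem exists_contraction_of_isSymmetric {P : E →ₗ[ℂ] E} (hP : P.IsSymmetric)
    (hev : ∀ μ : ℝ, Module.End.HasEigenvalue P (μ : ℂ) → 0 ≤ μ ∧ μ ≤ 1) :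
    ∃ β : ℝ, 0 < β ∧ β < 1 ∧ ∀ w ∈ (LinearMap.ker P)ᗮ, ‖w - P w‖ ≤ β * ‖w‖ := by
  set ev := hP.eigenvalues rfl with hevdef
  set b := hP.eigenvectorBasis rfl with hb
  have h01 : ∀ i, 0 ≤ ev i ∧ ev i ≤ 1 := fun i => hev _ (hP.hasEigenvalue_eigenvalues rfl i)
  -- Zero eigenvalues are replaced by 1, so that the product of all `g j` is a positive lower bound
  -- for the nonzero eigenvalues.
  set g : Fin (Module.finrank ℂ E) → ℝ := fun i => if ev i = 0 then 1 else ev i with hg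
  have hg0 : ∀ i, 0 < g i := by
    intro i
    by_cases h : ev i = 0
    · simp [hg, h]
    · simpa [hg, h] using lt_of_le_of_ne (h01 i).1 (Ne.symm h)
  have hg1 : ∀ i, g i ≤ 1 := by
    intro i
    by_cases h : ev i = 0
    · simp [hg, h]
    · simpa [hg, h] using (h01 i).2
  have hprod : ∀ i, ∏ j, g j ≤ g i := by
    intro i
    rw [← Finset.mul_prod_erase _ _ (Finset.mem_univ i)]
    exact mul_le_of_le_one_right (hg0 i).le
      (Finset.prod_le_one (fun j _ => (hg0 j).le) fun j _ => hg1 j)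
  have hpp : 0 < ∏ j, g j := Finset.prod_pos fun j _ => hg0 j
  -- The 1/2 only keeps the rate positive when all nonzero eigenvalues equal 1.
  refine ⟨max (1 - ∏ j, g j) (1 / 2), by positivity, max_lt (by linarith) (by norm_num), ?_⟩
  intro w hw
  set β := max (1 - ∏ j, g j) (1 / 2)
  have hβ0 : 0 ≤ β := le_trans (by norm_num) (le_max_right _ _)
  have hcoord : ∀ i, ‖inner ℂ (b i) (w - P w)‖ ≤ β * ‖inner ℂ (b i) w‖ := by
    intro i
    have hbi : P (b i) = (ev i : ℂ) • b i := hP.apply_eigenvectorBasis rfl i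
    have h1 : inner ℂ (b i) (w - P w) = ((1 - ev i : ℝ) : ℂ) * inner ℂ (b i) w := by
      rw [inner_sub_right, ← hP (b i) w, hbi, inner_smul_left]
      simp
      ring
    rw [h1, norm_mul, Complex.norm_real, Real.norm_of_nonneg (by linarith [(h01 i).2])]
    by_cases h : ev i = 0
    · have : inner ℂ (b i) w = 0 := by
        apply (Submodule.mem_orthogonal _ _).1 hw
        simp [hbi, h]
      simp [this]
    · refine mul_le_mul_of_nonneg_right (le_trans ?_ (le_max_left _ _)) (norm_nonneg _)
      have := hprod i
      simp only [hg, h, if_false] at this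
      linarith
  refine le_of_sq_le_sq ?_ (by positivity)
  rw [mul_pow, ← b.sum_sq_norm_inner_right (w - P w), ← b.sum_sq_norm_inner_right w, Finset.mul_sum]
  refine Finset.sum_le_sum fun i _ => ?_
  rw [← mul_pow]
  exact pow_le_pow_left₀ (norm_nonneg _) (hcoord i) 2

/-- Stability and exponential convergence of the iterates of `f x ≈ x - P (x - x₀)`, when the error
is small compared to the distance of `x - x₀` to `ker P`. -/
theorem exp_convergence_of_isSymmetric {P : E →ₗ[ℂ] E} (hP : P.IsSymmetric)
    (hev : ∀ μ : ℝ, Module.End.HasEigenvalue P (μ : ℂ) → 0 ≤ μ ∧ μ ≤ 1)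
    (f : E → E) (x₀ : E) (U : Set E)
    (hf : ∀ ε : ℝ, 0 < ε → ∃ δ : ℝ, 0 < δ ∧ ∀ x ∈ U, ‖x - x₀‖ < δ → ∀ y, P y = 0 →
      ‖f x - x + P (x - x₀)‖ ≤ ε * ‖x - x₀ - y‖)
    (hU : ∃ δ : ℝ, 0 < δ ∧ ∀ x ∈ U, ‖x - x₀‖ < δ → f x ∈ U) :
    ∃ β : ℝ, 0 < β ∧ β < 1 ∧ ∀ ε : ℝ, 0 < ε → ∃ δ κ : ℝ, 0 < δ ∧ 0 < κ ∧
      ∀ x : ℕ → E, x 0 ∈ U → ‖x 0 - x₀‖ < δ → (∀ k, x (k + 1) = f (x k)) →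
        (∀ k, x k ∈ U ∧ ‖x k - x₀‖ < ε) ∧ ∃ l, P (l - x₀) = 0 ∧ Tendsto x atTop (𝓝 l) ∧
          ‖l - x₀‖ ≤ ε ∧ ∀ k, ‖x k - l‖ ≤ κ * β ^ k := by
  obtain ⟨β, hβ0, hβ1, hβ⟩ := exists_contraction_of_isSymmetric hP hev
  set N := LinearMap.ker P with hN
  -- Half of the spectral gap is given to the error, which leaves the rate γ = (1 + β)/2 < 1.
  set η := (1 - β) / 2 with hη
  have hη0 : 0 < η := by rw [hη]; linarith
  set γ := β + η with hγ
  have hγ1 : γ < 1 := by rw [hγ, hη]; linarith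
  have hγ0 : 0 < γ := by positivity
  obtain ⟨δ₁, hδ₁, hf⟩ := hf η hη0
  obtain ⟨δ₂, hδ₂, hU⟩ := hU
  set R : E →L[ℂ] E := Nᗮ.starProjection with hR
  have hRmem : ∀ x, R x ∈ Nᗮ := fun x => Submodule.starProjection_apply_mem _ x
  have hRnorm : ∀ x, ‖R x‖ ≤ ‖x‖ := fun x => Submodule.norm_starProjection_apply_le _ x
  have hsub : ∀ x, x - R x ∈ N := by
    intro x
    have := Submodule.sub_starProjection_mem_orthogonal (K := Nᗮ) x
    rwa [Submodule.orthogonal_orthogonal] at this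
  have hPR : ∀ x, P x = P (R x) := by
    intro x
    have : P (x - R x) = 0 := hsub x
    rwa [map_sub, sub_eq_zero] at this
  have hrange : ∀ x, P x ∈ Nᗮ := by
    intro x
    rw [Submodule.mem_orthogonal]
    intro u hu
    have hu' : P u = 0 := hu
    rw [← hP u x, hu', inner_zero_left]
  have hRfix : ∀ x ∈ Nᗮ, R x = x := fun x hx => Submodule.starProjection_eq_self_iff.2 hx
  have key : ∀ x ∈ U, ‖x - x₀‖ < δ₁ → ‖R (f x - x₀)‖ ≤ γ * ‖R (x - x₀)‖ ∧
      ‖f x - x‖ ≤ 3 * ‖R (x - x₀)‖ := by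
    intro x hxU hx
    set w := R (x - x₀) with hw
    set r := f x - x + P (x - x₀) with hr
    -- The kernel component of `x - x₀` is the choice of `y` that leaves only the transversal part
    -- `w` in the bound.
    have hrb : ‖r‖ ≤ η * ‖w‖ := by
      have := hf x hxU hx (x - x₀ - w) (hsub _)
      rwa [sub_sub_cancel] at this
    have hww := hβ w (hRmem _)
    have hPw : P (x - x₀) = P w := hPR _
    constructor
    · have : R (f x - x₀) = (w - P w) + R r := by
        have h1 : f x - x₀ = (x - x₀) - P w + r := by rw [hr, hPw]; abel
        rw [h1, map_add, map_sub, hRfix _ (hrange w)]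
      rw [this]
      calc ‖(w - P w) + R r‖ ≤ ‖w - P w‖ + ‖R r‖ := norm_add_le _ _
        _ ≤ β * ‖w‖ + η * ‖w‖ := add_le_add hww ((hRnorm r).trans hrb)
        _ = γ * ‖w‖ := by rw [hγ]; ring
    · have h1 : f x - x = (w - P w) - w + r := by rw [hr, hPw]; abel
      have hη1 : η ≤ 1 := by rw [hη]; linarith
      rw [h1]
      calc ‖(w - P w) - w + r‖ ≤ ‖w - P w‖ + ‖w‖ + ‖r‖ :=
            (norm_add_le _ _).trans (add_le_add_left (norm_sub_le _ _) _)
        _ ≤ 1 * ‖w‖ + ‖w‖ + 1 * ‖w‖ := by gcongr <;> nlinarith [norm_nonneg w]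
        _ = 3 * ‖w‖ := by ring
  refine ⟨γ, hγ0, hγ1, fun ε hε => ?_⟩
  -- Step k has length at most 3γ^k a, where a is the initial distance, so no iterate is farther
  -- than M a from `x₀`; δ makes this smaller than all the radii.
  set M := 1 + 3 / (1 - γ) with hM
  have h1γ : 0 < 1 - γ := by linarith
  have hM0 : 0 < M := by positivity
  set δ := min ε (min δ₁ δ₂) / M with hδ
  have hmin : 0 < min ε (min δ₁ δ₂) := by positivity
  have hδ0 : 0 < δ := by positivity
  refine ⟨δ, 3 * δ / (1 - γ), hδ0, by positivity, ?_⟩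
  intro x hx0U hx0 hx
  set a := ‖x 0 - x₀‖ with ha
  have ha0 : 0 ≤ a := norm_nonneg _
  have hMa : M * a < min ε (min δ₁ δ₂) := by
    have := (lt_div_iff₀ hM0).1 hx0
    linarith
  have hgeom : ∀ k, a + 3 * a * ∑ i ∈ Finset.range k, γ ^ i ≤ M * a := by
    intro k
    have : ∑ i ∈ Finset.range k, γ ^ i ≤ 1 / (1 - γ) := by
      rw [geom_sum_eq hγ1.ne, ← neg_div_neg_eq]
      gcongr
      · linarith [pow_pos hγ0 k]
      · linarith
    have h3 : 3 * a * ∑ i ∈ Finset.range k, γ ^ i ≤ 3 * a * (1 / (1 - γ)) := by gcongr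
    rw [hM, add_mul, one_mul]
    refine (add_le_add_right h3 a).trans (le_of_eq ?_)
    ring
  have ind : ∀ k, x k ∈ U ∧ ‖R (x k - x₀)‖ ≤ γ ^ k * a ∧
      ‖x k - x₀‖ ≤ a + 3 * a * ∑ i ∈ Finset.range k, γ ^ i := by
    intro k
    induction k with
    | zero => exact ⟨hx0U, by simpa only [pow_zero, one_mul] using hRnorm _, by simp [ha]⟩
    | succ k ih =>
      obtain ⟨h0, h1, h2⟩ := ih
      have hlt : ‖x k - x₀‖ < min ε (min δ₁ δ₂) := (h2.trans (hgeom k)).trans_lt hMa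
      have hlt1 : ‖x k - x₀‖ < δ₁ := hlt.trans_le ((min_le_right _ _).trans (min_le_left _ _))
      have hlt2 : ‖x k - x₀‖ < δ₂ := hlt.trans_le ((min_le_right _ _).trans (min_le_right _ _))
      obtain ⟨k1, k2⟩ := key _ h0 hlt1
      rw [hx k]
      refine ⟨hU _ h0 hlt2, ?_, ?_⟩
      · refine k1.trans ((mul_le_mul_of_nonneg_left h1 hγ0.le).trans (le_of_eq ?_))
        ring
      · have : f (x k) - x₀ = (x k - x₀) + (f (x k) - x k) := by abel
        rw [this, Finset.sum_range_succ]
        refine (norm_add_le _ _).trans ?_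
        have h5 : 3 * ‖R (x k - x₀)‖ ≤ 3 * (γ ^ k * a) := by gcongr
        nlinarith [k2.trans h5]
  have hlt : ∀ k, ‖x k - x₀‖ < min ε (min δ₁ δ₂) := fun k =>
    (((ind k).2.2).trans (hgeom k)).trans_lt hMa
  have hstep : ∀ k, dist (x k) (x (k + 1)) ≤ 3 * δ * γ ^ k := by
    intro k
    have hlt1 : ‖x k - x₀‖ < δ₁ :=
      (hlt k).trans_le ((min_le_right _ _).trans (min_le_left _ _))
    rw [dist_comm, dist_eq_norm, hx k]
    refine ((key _ (ind k).1 hlt1).2).trans ?_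
    have h1 := (ind k).2.1
    have h2 : γ ^ k * a ≤ γ ^ k * δ := by gcongr
    nlinarith
  have : CompleteSpace E := FiniteDimensional.complete ℂ E
  obtain ⟨l, hl⟩ := cauchySeq_tendsto_of_complete (cauchySeq_of_le_geometric γ _ hγ1 hstep)
  refine ⟨fun k => ⟨(ind k).1, (hlt k).trans_le (min_le_left _ _)⟩, l, ?_, hl, ?_, ?_⟩
  · have h1 : Tendsto (fun k => R (x k - x₀)) atTop (𝓝 (R (l - x₀))) :=
      (R.continuous.tendsto _).comp (hl.sub_const x₀)
    have h2 : Tendsto (fun k => R (x k - x₀)) atTop (𝓝 0) := by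
      refine squeeze_zero_norm (fun k => (ind k).2.1) ?_
      simpa using (tendsto_pow_atTop_nhds_zero_of_lt_one hγ0.le hγ1).mul_const a
    rw [hPR, tendsto_nhds_unique h1 h2, map_zero]
  · exact le_of_tendsto (hl.sub_const x₀).norm
      (Eventually.of_forall fun k => ((hlt k).trans_le (min_le_left _ _)).le)
  · intro k
    have := dist_le_of_le_geometric_of_tendsto γ _ hγ1 hstep hl k
    rw [dist_eq_norm] at this
    refine this.trans (le_of_eq ?_)
    ring

/-- The same in a normed space with a linear isomorphism onto an inner product space that makes
`P` symmetric. -/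
theorem exp_convergence_of_conj {V : Type*} [NormedAddCommGroup V] [NormedSpace ℂ V]
    [FiniteDimensional ℂ V] (e : V ≃ₗ[ℂ] E) {P : V →ₗ[ℂ] V}
    (hP : ∀ x y, inner ℂ (e (P x)) (e y) = inner ℂ (e x) (e (P y)))
    (hev : ∀ (μ : ℝ) (x : V), x ≠ 0 → P x = (μ : ℂ) • x → 0 ≤ μ ∧ μ ≤ 1)
    (f : V → V) (x₀ : V) (U : Set V)
    (hf : ∀ ε : ℝ, 0 < ε → ∃ δ : ℝ, 0 < δ ∧ ∀ x ∈ U, ‖x - x₀‖ < δ → ∀ y, P y = 0 →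
      ‖f x - x + P (x - x₀)‖ ≤ ε * ‖x - x₀ - y‖)
    (hU : ∃ δ : ℝ, 0 < δ ∧ ∀ x ∈ U, ‖x - x₀‖ < δ → f x ∈ U) :
    ∃ β : ℝ, 0 < β ∧ β < 1 ∧ ∀ ε : ℝ, 0 < ε → ∃ δ κ : ℝ, 0 < δ ∧ 0 < κ ∧
      ∀ x : ℕ → V, x 0 ∈ U → ‖x 0 - x₀‖ < δ → (∀ k, x (k + 1) = f (x k)) →
        (∀ k, x k ∈ U ∧ ‖x k - x₀‖ < ε) ∧ ∃ l, P (l - x₀) = 0 ∧ Tendsto x atTop (𝓝 l) ∧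
          ‖l - x₀‖ ≤ ε ∧ ∀ k, ‖x k - l‖ ≤ κ * β ^ k := by
  obtain ⟨a, ha, hea⟩ := e.toContinuousLinearEquiv.toContinuousLinearMap.bound
  obtain ⟨c, hc, hec⟩ := e.symm.toContinuousLinearEquiv.toContinuousLinearMap.bound
  replace hea : ∀ x, ‖e x‖ ≤ a * ‖x‖ := hea
  replace hec : ∀ x, ‖e.symm x‖ ≤ c * ‖x‖ := hec
  have hec' : ∀ x, ‖x‖ ≤ c * ‖e x‖ := fun x => by simpa using hec (e x)
  have hclose : ∀ (δ : ℝ) (x : E), ‖x - e x₀‖ < δ / c → ‖e.symm x - x₀‖ < δ := by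
    intro δ x hx
    have := hec (x - e x₀)
    rw [map_sub, e.symm_apply_apply] at this
    exact this.trans_lt (by rwa [lt_div_iff₀' hc] at hx)
  -- Everything is transported by `e`; its norm bounds a and c change the radii and κ, but not the
  -- rate β.
  obtain ⟨β, hβ0, hβ1, H⟩ := exp_convergence_of_isSymmetric
    (P := e.toLinearMap ∘ₗ P ∘ₗ e.symm.toLinearMap)
    (fun x y => by simpa using hP (e.symm x) (e.symm y))
    (fun μ hμ => by
      obtain ⟨v, hv⟩ := hμ.exists_hasEigenvector
      refine hev μ (e.symm v) (by simpa using hv.2) ?_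
      have h : e (P (e.symm v)) = (μ : ℂ) • v := hv.apply_eq_smul
      rw [← e.symm_apply_apply (P (e.symm v)), h, map_smul])
    (fun x => e (f (e.symm x))) (e x₀) (e '' U)
    (fun ε hε => by
      obtain ⟨δ, hδ, h⟩ := hf (ε / (a * c)) (by positivity)
      refine ⟨δ / c, by positivity, ?_⟩
      rintro _ ⟨x, hx, rfl⟩ hlt y hy
      have hlt' := hclose δ _ hlt
      rw [e.symm_apply_apply] at hlt'
      have h1 := h x hx hlt' (e.symm y) (by simpa using hy)
      have h2 : e (f (e.symm (e x))) - e x + (e.toLinearMap ∘ₗ P ∘ₗ e.symm.toLinearMap)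
          (e x - e x₀) = e (f x - x + P (x - x₀)) := by simp
      rw [h2]
      have h3 := hec' (x - x₀ - e.symm y)
      have h4 : e (x - x₀ - e.symm y) = e x - e x₀ - y := by simp
      rw [h4] at h3
      calc _ ≤ a * ‖f x - x + P (x - x₀)‖ := hea _
        _ ≤ a * (ε / (a * c) * (c * ‖e x - e x₀ - y‖)) := by
            gcongr
            exact h1.trans (by gcongr)
        _ = ε * ‖e x - e x₀ - y‖ := by field_simp)
    (by
      obtain ⟨δ, hδ, h⟩ := hU
      refine ⟨δ / c, by positivity, ?_⟩
      rintro _ ⟨x, hx, rfl⟩ hlt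
      have hlt' := hclose δ _ hlt
      rw [e.symm_apply_apply] at hlt'
      exact ⟨f x, h x hx hlt', by simp⟩)
  refine ⟨β, hβ0, hβ1, fun ε hε => ?_⟩
  obtain ⟨δ, κ, hδ, hκ, H⟩ := H (ε / c) (by positivity)
  refine ⟨δ / a, c * κ, by positivity, by positivity, ?_⟩
  intro x hx0 hxδ hx
  obtain ⟨h1, l, hl1, hl2, hl3, hl4⟩ := H (fun k => e (x k)) ⟨_, hx0, rfl⟩ (by
      rw [← map_sub]
      exact (hea _).trans_lt (by rwa [lt_div_iff₀' ha] at hxδ)) (fun k => by simp [hx])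
  refine ⟨fun k => ⟨?_, ?_⟩, e.symm l, ?_, ?_, ?_, ?_⟩
  · obtain ⟨y, hy, hxy⟩ := (h1 k).1
    rwa [← e.injective hxy]
  · simpa using hclose ε _ (h1 k).2
  · have h : e (P (e.symm (l - e x₀))) = 0 := hl1
    rwa [e.map_eq_zero_iff, map_sub, e.symm_apply_apply] at h
  · have := (e.symm.toContinuousLinearEquiv.continuous.tendsto l).comp hl2
    simpa [Function.comp_def] using this
  · have := hec (l - e x₀)
    rw [map_sub, e.symm_apply_apply] at this
    exact this.trans (by rwa [le_div_iff₀' hc] at hl3)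
  · intro k
    have := hec (e (x k) - l)
    rw [map_sub, e.symm_apply_apply] at this
    refine this.trans ((mul_le_mul_of_nonneg_left (hl4 k) hc.le).trans (le_of_eq ?_))
    ring

end Abstract

/-! ### Means over the unit circle -/

open Matrix

/-- The mean of a function on the unit circle. -/
noncomputable def avg (φ : Circle → ℂ) : ℂ :=
  (2 * (Real.pi : ℂ))⁻¹ * ∫ ϑ in (-Real.pi)..Real.pi, φ (Circle.exp ϑ)

theorem intervalIntegrable_comp_exp {φ : Circle → ℂ} (hφ : Continuous φ) (a b : ℝ) :
    IntervalIntegrable (fun ϑ : ℝ => φ (Circle.exp ϑ)) MeasureTheory.volume a b :=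
  (hφ.comp Circle.exp.continuous).intervalIntegrable _ _

theorem avg_add {φ ψ : Circle → ℂ} (hφ : Continuous φ) (hψ : Continuous ψ) :
    avg (fun z => φ z + ψ z) = avg φ + avg ψ := by
  simp only [avg]
  rw [intervalIntegral.integral_add (intervalIntegrable_comp_exp hφ _ _)
    (intervalIntegrable_comp_exp hψ _ _), mul_add]

theorem avg_sub {φ ψ : Circle → ℂ} (hφ : Continuous φ) (hψ : Continuous ψ) :
    avg (fun z => φ z - ψ z) = avg φ - avg ψ := by
  simp only [avg]
  rw [intervalIntegral.integral_sub (intervalIntegrable_comp_exp hφ _ _)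
    (intervalIntegrable_comp_exp hψ _ _), mul_sub]

theorem avg_const_mul (c : ℂ) (φ : Circle → ℂ) : avg (fun z => c * φ z) = c * avg φ := by
  simp only [avg]
  rw [intervalIntegral.integral_const_mul]
  ring

theorem avg_sum {ι : Type*} (s : Finset ι) {φ : ι → Circle → ℂ} (hφ : ∀ i, Continuous (φ i)) :
    avg (fun z => ∑ i ∈ s, φ i z) = ∑ i ∈ s, avg (φ i) := by
  simp only [avg]
  rw [intervalIntegral.integral_finsetSum fun i _ => intervalIntegrable_comp_exp (hφ i) _ _,
    Finset.mul_sum]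

theorem avg_star (φ : Circle → ℂ) : avg (fun z => star (φ z)) = star (avg φ) := by
  simp only [avg, star_mul', intervalIntegral]
  rw [star_sub]
  simp only [Complex.star_def, integral_conj, map_inv₀, map_mul, Complex.conj_ofReal, map_ofNat]

theorem avg_ofReal (f : Circle → ℝ) : avg (fun z => (f z : ℂ)) =
    (((2 * Real.pi)⁻¹ * ∫ ϑ in (-Real.pi)..Real.pi, f (Circle.exp ϑ) : ℝ) : ℂ) := by
  simp only [avg]
  rw [intervalIntegral.integral_ofReal]
  push_cast
  ring

theorem norm_avg_le_re {φ : Circle → ℂ} {f : Circle → ℝ} (hf : Continuous f)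
    (h : ∀ z, ‖φ z‖ ≤ f z) : ‖avg φ‖ ≤ (avg fun z => (f z : ℂ)).re := by
  rw [avg_ofReal, Complex.ofReal_re, avg, norm_mul]
  have h1 : ‖(2 * (Real.pi : ℂ))⁻¹‖ = (2 * Real.pi)⁻¹ := by
    simp [abs_of_pos Real.pi_pos]
  rw [h1]
  have hpi := Real.pi_pos
  gcongr
  refine intervalIntegral.norm_integral_le_of_norm_le (by linarith)
    (Eventually.of_forall fun t _ => h _) ?_
  exact (hf.comp Circle.exp.continuous).intervalIntegrable _ _

theorem norm_avg_le {φ : Circle → ℂ} {M : ℝ} (h : ∀ z, ‖φ z‖ ≤ M) : ‖avg φ‖ ≤ M := by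
  refine (norm_avg_le_re (f := fun _ => M) continuous_const h).trans (le_of_eq ?_)
  have hpi := Real.pi_pos
  rw [avg_ofReal, Complex.ofReal_re, intervalIntegral.integral_const, smul_eq_mul]
  field_simp
  ring

theorem avg_ofReal_nonneg {f : Circle → ℝ} (h : ∀ z, 0 ≤ f z) :
    0 ≤ (avg fun z => (f z : ℂ)).re := by
  rw [avg_ofReal, Complex.ofReal_re]
  have hpi := Real.pi_pos
  exact mul_nonneg (by positivity)
    (intervalIntegral.integral_nonneg (by linarith) fun t _ => h _)

/-- Every step from an integral identity to a pointwise one on the circle rests on this. -/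
theorem eq_zero_of_avg_eq_zero {f : Circle → ℝ} (hf : Continuous f) (h : ∀ z, 0 ≤ f z)
    (h0 : avg (fun z => (f z : ℂ)) = 0) (z : Circle) : f z = 0 := by
  have hpi := Real.pi_pos
  by_contra hne
  have hpos : 0 < f z := lt_of_le_of_ne (h z) (Ne.symm hne)
  rw [avg_ofReal, Complex.ofReal_eq_zero] at h0
  have h1 : 0 < ∫ ϑ in (-Real.pi)..Real.pi, f (Circle.exp ϑ) := by
    refine intervalIntegral.integral_pos (by linarith)
      (hf.comp Circle.exp.continuous).continuousOn (fun t _ => h _)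
      ⟨Complex.arg z, ⟨(Complex.neg_pi_lt_arg _).le, Complex.arg_le_pi _⟩, ?_⟩
    rwa [Circle.exp_arg]
  have h2 : 0 < (2 * Real.pi)⁻¹ * ∫ ϑ in (-Real.pi)..Real.pi, f (Circle.exp ϑ) := by positivity
  exact h2.ne' h0

/-! ### The transfer function and its quadratic forms -/

variable {n : ℕ} {A : Matrix (Fin n) (Fin n) ℂ} {B : Fin n → ℂ}

/-- The spectrum of `A` misses the unit circle, so the resolvent has no pole there. -/
theorem continuous_transfer (hA : IsStabilityMatrix A) : Continuous (transfer A B) := by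
  have hdet : ∀ z : Circle, ((z : ℂ) • (1 : Matrix (Fin n) (Fin n) ℂ) - A).det ≠ 0 := by
    intro z hz
    have hmem : (z : ℂ) ∈ spectrum ℂ A := by
      rw [spectrum.mem_iff, Algebra.algebraMap_eq_smul_one, Matrix.isUnit_iff_isUnit_det, hz]
      exact not_isUnit_zero
    exact (hA _ hmem).ne (Circle.norm_coe z)
  have hc : Continuous fun z : Circle => (z : ℂ) • (1 : Matrix (Fin n) (Fin n) ℂ) - A :=
    (continuous_subtype_val.smul continuous_const).sub continuous_const
  refine Continuous.matrix_mulVec ?_ continuous_const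
  refine continuous_iff_continuousAt.2 fun z => ?_
  refine ContinuousAt.comp (f := fun z : Circle => (z : ℂ) • (1 : Matrix (Fin n) (Fin n) ℂ) - A)
    (g := fun M => M⁻¹) ?_ hc.continuousAt
  refine continuousAt_matrix_inv _ ?_
  rw [Ring.inverse_eq_inv']
  exact continuousAt_inv₀ (hdet z)

theorem continuous_transfer_apply (hA : IsStabilityMatrix A) (i : Fin n) :
    Continuous fun z => transfer A B z i :=
  (continuous_apply i).comp (continuous_transfer hA)

theorem continuous_quadForm (hA : IsStabilityMatrix A) (X : Matrix (Fin n) (Fin n) ℂ) :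
    Continuous (quadForm A B X) :=
  (continuous_transfer hA).star.dotProduct
    (continuous_const.matrix_mulVec (continuous_transfer hA))

theorem quadForm_eq_sum (X : Matrix (Fin n) (Fin n) ℂ) (z : Circle) : quadForm A B X z =
    ∑ i, ∑ j, X i j * (transfer A B z j * star (transfer A B z i)) := by
  simp only [quadForm, dotProduct, mulVec, Finset.mul_sum, Pi.star_apply]
  exact Finset.sum_congr rfl fun i _ => Finset.sum_congr rfl fun j _ => by ring

theorem quadForm_add (X Y : Matrix (Fin n) (Fin n) ℂ) (z : Circle) :
    quadForm A B (X + Y) z = quadForm A B X z + quadForm A B Y z := by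
  simp [quadForm, add_mulVec]

theorem quadForm_sub (X Y : Matrix (Fin n) (Fin n) ℂ) (z : Circle) :
    quadForm A B (X - Y) z = quadForm A B X z - quadForm A B Y z := by
  simp [quadForm, sub_mulVec]

theorem quadForm_smul (c : ℂ) (X : Matrix (Fin n) (Fin n) ℂ) (z : Circle) :
    quadForm A B (c • X) z = c * quadForm A B X z := by
  simp [quadForm, smul_mulVec]

theorem quadForm_conjTranspose (X : Matrix (Fin n) (Fin n) ℂ) (z : Circle) :
    quadForm A B Xᴴ z = star (quadForm A B X z) := by
  rw [quadForm, quadForm, star_dotProduct, star_mulVec, conjTranspose_conjTranspose,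
    ← dotProduct_mulVec]

theorem quadForm_im_of_isHermitian {X : Matrix (Fin n) (Fin n) ℂ} (hX : X.IsHermitian)
    (z : Circle) : ((quadForm A B X z).re : ℂ) = quadForm A B X z := by
  have h := quadForm_conjTranspose (A := A) (B := B) X z
  rw [hX.eq] at h
  exact Complex.conj_eq_iff_re.1 h.symm

/-! ### Frobenius norm and moment estimates -/

theorem frobenius_norm_sq (X : Matrix (Fin n) (Fin n) ℂ) : ‖X‖ ^ 2 = ∑ i, ∑ j, ‖X i j‖ ^ 2 := by
  rw [frobenius_norm_def, ← Real.rpow_natCast, ← Real.rpow_mul (by positivity)]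
  simp

theorem norm_apply_le (X : Matrix (Fin n) (Fin n) ℂ) (i j : Fin n) : ‖X i j‖ ≤ ‖X‖ := by
  refine le_of_sq_le_sq ?_ (norm_nonneg _)
  rw [frobenius_norm_sq]
  exact (Finset.single_le_sum (f := fun j => ‖X i j‖ ^ 2) (fun _ _ => by positivity)
    (Finset.mem_univ j)).trans (Finset.single_le_sum (f := fun i => ∑ j, ‖X i j‖ ^ 2)
      (fun _ _ => by positivity) (Finset.mem_univ i))

theorem norm_le_of_forall_apply_le {X : Matrix (Fin n) (Fin n) ℂ} {m : ℝ} (hm : 0 ≤ m)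
    (h : ∀ i j, ‖X i j‖ ≤ m) : ‖X‖ ≤ n * m := by
  refine le_of_sq_le_sq ?_ (by positivity)
  rw [frobenius_norm_sq]
  calc _ ≤ ∑ i : Fin n, ∑ j : Fin n, m ^ 2 := by gcongr; exact h _ _
    _ = (n * m) ^ 2 := by simp; ring

/-- Crude bound of a sesquilinear form by the Frobenius norm. -/
theorem norm_dotProduct_mulVec_le (X : Matrix (Fin n) (Fin n) ℂ) (v : Fin n → ℂ) :
    ‖star v ⬝ᵥ X *ᵥ v‖ ≤ ‖X‖ * (∑ i, ‖v i‖) ^ 2 := by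
  simp only [dotProduct, mulVec, Finset.mul_sum, Pi.star_apply]
  rw [sq, Finset.sum_mul_sum, Finset.mul_sum]
  refine (norm_sum_le _ _).trans (Finset.sum_le_sum fun i _ => ?_)
  rw [Finset.mul_sum]
  refine (norm_sum_le _ _).trans (Finset.sum_le_sum fun j _ => ?_)
  rw [norm_mul, norm_mul, norm_star]
  nlinarith [mul_le_mul_of_nonneg_right (norm_apply_le X i j)
    (mul_nonneg (norm_nonneg (v i)) (norm_nonneg (v j)))]

theorem moment_apply (φ : Circle → ℂ) (i j : Fin n) : moment A B φ i j =
    avg fun z => transfer A B z i * φ z * star (transfer A B z j) := rfl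

theorem continuous_moment_integrand (hA : IsStabilityMatrix A) {φ : Circle → ℂ}
    (hφ : Continuous φ) (i j : Fin n) :
    Continuous fun z => transfer A B z i * φ z * star (transfer A B z j) :=
  ((continuous_transfer_apply hA i).mul hφ).mul (continuous_transfer_apply hA j).star

theorem moment_add (hA : IsStabilityMatrix A) {φ ψ : Circle → ℂ} (hφ : Continuous φ)
    (hψ : Continuous ψ) :
    moment A B (fun z => φ z + ψ z) = moment A B φ + moment A B ψ := by
  ext i j
  rw [Matrix.add_apply, moment_apply, moment_apply, moment_apply,
    ← avg_add (continuous_moment_integrand hA hφ i j) (continuous_moment_integrand hA hψ i j)]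
  simp only [mul_add, add_mul]

theorem moment_sub (hA : IsStabilityMatrix A) {φ ψ : Circle → ℂ} (hφ : Continuous φ)
    (hψ : Continuous ψ) :
    moment A B (fun z => φ z - ψ z) = moment A B φ - moment A B ψ := by
  ext i j
  rw [Matrix.sub_apply, moment_apply, moment_apply, moment_apply,
    ← avg_sub (continuous_moment_integrand hA hφ i j) (continuous_moment_integrand hA hψ i j)]
  simp only [mul_sub, sub_mul]

theorem moment_const_mul (c : ℂ) (φ : Circle → ℂ) :
    moment A B (fun z => c * φ z) = c • moment A B φ := by
  ext i j
  rw [Matrix.smul_apply, moment_apply, moment_apply, smul_eq_mul, ← avg_const_mul]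
  congr 1
  ext z
  ring

theorem moment_conjTranspose (φ : Circle → ℂ) :
    (moment A B φ)ᴴ = moment A B fun z => star (φ z) := by
  ext i j
  rw [conjTranspose_apply, moment_apply, moment_apply, ← avg_star]
  congr 1
  ext z
  simp only [star_mul', star_star]
  ring

/-- The duality between moments and quadratic forms: `Y ↦ G*YG` is adjoint to `φ ↦ ∫ G φ G*`. -/
theorem trace_mul_moment (hA : IsStabilityMatrix A) (Y : Matrix (Fin n) (Fin n) ℂ)
    {φ : Circle → ℂ} (hφ : Continuous φ) :
    (Y * moment A B φ).trace = avg fun z => φ z * quadForm A B Y z := by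
  have h : (fun z => φ z * quadForm A B Y z) = fun z => ∑ i, ∑ j,
      Y i j * (transfer A B z j * φ z * star (transfer A B z i)) := by
    ext z
    rw [quadForm_eq_sum, Finset.mul_sum]
    refine Finset.sum_congr rfl fun i _ => ?_
    rw [Finset.mul_sum]
    exact Finset.sum_congr rfl fun j _ => by ring
  have hc : ∀ i j, Continuous fun z =>
      Y i j * (transfer A B z j * φ z * star (transfer A B z i)) := fun i j =>
    continuous_const.mul (continuous_moment_integrand hA hφ j i)
  rw [h, avg_sum _ fun i => continuous_finsetSum _ fun j _ => hc i j, trace]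
  refine Finset.sum_congr rfl fun i _ => ?_
  rw [avg_sum _ (hc i), diag_apply, mul_apply]
  exact Finset.sum_congr rfl fun j _ => by rw [avg_const_mul, moment_apply]

theorem exists_norm_transfer_le (hA : IsStabilityMatrix A) (B : Fin n → ℂ) :
    ∃ C : ℝ, 0 < C ∧ ∀ z, ∑ i, ‖transfer A B z i‖ ≤ C := by
  have hc : Continuous fun z => ∑ i, ‖transfer A B z i‖ :=
    continuous_finsetSum _ fun i _ => (continuous_transfer_apply hA i).norm
  obtain ⟨C, hC⟩ := (isCompact_range hc).bddAbove
  exact ⟨max C 1, by positivity, fun z => (hC ⟨z, rfl⟩).trans (le_max_left _ _)⟩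

theorem exists_norm_quadForm_le (hA : IsStabilityMatrix A) (B : Fin n → ℂ) :
    ∃ C : ℝ, 0 < C ∧ ∀ (X : Matrix (Fin n) (Fin n) ℂ) z, ‖quadForm A B X z‖ ≤ C * ‖X‖ := by
  obtain ⟨C, hC, h⟩ := exists_norm_transfer_le hA B
  refine ⟨C ^ 2, by positivity, fun X z => (norm_dotProduct_mulVec_le X _).trans ?_⟩
  rw [mul_comm]
  gcongr
  exact h z

theorem exists_norm_moment_le (hA : IsStabilityMatrix A) (B : Fin n → ℂ) :
    ∃ C : ℝ, 0 < C ∧ ∀ (φ : Circle → ℂ) (M : ℝ), (∀ z, ‖φ z‖ ≤ M) → ‖moment A B φ‖ ≤ C * M := by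
  obtain ⟨C, hC, h⟩ := exists_norm_transfer_le hA B
  refine ⟨n * C ^ 2 + 1, by positivity, fun φ M hφ => ?_⟩
  have hM : 0 ≤ M := (norm_nonneg _).trans (hφ 1)
  have hi : ∀ z i, ‖transfer A B z i‖ ≤ C := fun z i =>
    (Finset.single_le_sum (f := fun i => ‖transfer A B z i‖) (fun i _ => norm_nonneg _)
      (Finset.mem_univ i)).trans (h z)
  refine (norm_le_of_forall_apply_le (m := C ^ 2 * M) (by positivity) fun i j => ?_).trans
    (by nlinarith)
  rw [moment_apply]
  refine norm_avg_le fun z => ?_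
  rw [norm_mul, norm_mul, norm_star]
  calc _ ≤ C * M * C := by gcongr <;> first | exact hi _ _ | exact hφ _
    _ = C ^ 2 * M := by ring

/-! ### Positive definite matrices and their square roots -/

theorem sqrt_mul_sqrt_of_posDef {Λ : Matrix (Fin n) (Fin n) ℂ} (h : Λ.PosDef) :
    CFC.sqrt Λ * CFC.sqrt Λ = Λ :=
  CFC.sqrt_mul_sqrt_self Λ h.posSemidef.nonneg

theorem posDef_sqrt {Λ : Matrix (Fin n) (Fin n) ℂ} (h : Λ.PosDef) : (CFC.sqrt Λ).PosDef := by
  have h1 : (CFC.sqrt Λ).PosSemidef := nonneg_iff_posSemidef.1 (CFC.sqrt_nonneg Λ)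
  refine h1.posDef_iff_isUnit.2 ?_
  have := h.isUnit
  rw [← sqrt_mul_sqrt_of_posDef h] at this
  exact isUnit_of_mul_isUnit_left this

theorem trace_conjTranspose_mul_self (X : Matrix (Fin n) (Fin n) ℂ) :
    (Xᴴ * X).trace = ((‖X‖ ^ 2 : ℝ) : ℂ) := by
  rw [frobenius_norm_sq, Finset.sum_comm, trace]
  push_cast
  refine Finset.sum_congr rfl fun i _ => ?_
  rw [diag_apply, mul_apply]
  refine Finset.sum_congr rfl fun j _ => ?_
  rw [conjTranspose_apply, Complex.star_def, Complex.conj_mul']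

theorem norm_trace_le (X : Matrix (Fin n) (Fin n) ℂ) : ‖X.trace‖ ≤ n * ‖X‖ := by
  refine (norm_sum_le _ _).trans ?_
  refine (Finset.sum_le_sum fun i _ => norm_apply_le X i i).trans (le_of_eq ?_)
  simp

theorem posDef_one_add_of_norm_lt {D : Matrix (Fin n) (Fin n) ℂ} (hD : D.IsHermitian)
    (h : n * ‖D‖ < 1) : (1 + D).PosDef := by
  refine PosDef.of_dotProduct_mulVec_pos (isHermitian_one.add hD) fun v hv => ?_
  have hherm : (1 + D).IsHermitian := isHermitian_one.add hD
  have him : (star v ⬝ᵥ (1 + D) *ᵥ v).im = 0 := by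
    simpa using hherm.im_star_dotProduct_mulVec_self v
  refine Complex.pos_iff.2 ⟨?_, him.symm⟩
  rw [add_mulVec, one_mulVec, dotProduct_add, Complex.add_re]
  have h1 : (star v ⬝ᵥ v).re = ∑ i, ‖v i‖ ^ 2 := by
    simp [dotProduct, Complex.conj_mul', ← Complex.ofReal_pow]
  have h2 := (abs_le.1 ((Complex.abs_re_le_norm _).trans (norm_dotProduct_mulVec_le D v))).1
  have h3 : (∑ i, ‖v i‖) ^ 2 ≤ n * ∑ i, ‖v i‖ ^ 2 := by
    simpa using sq_sum_le_card_mul_sum_sq (s := Finset.univ) (f := fun i => ‖v i‖)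
  have h4 : 0 < ∑ i, ‖v i‖ ^ 2 := by
    obtain ⟨i, hi⟩ := Function.ne_iff.1 hv
    exact Finset.sum_pos' (fun _ _ => by positivity) ⟨i, Finset.mem_univ i, by
      have : 0 < ‖v i‖ := norm_pos_iff.2 hi
      positivity⟩
  rw [h1]
  have h5 := mul_le_mul_of_nonneg_left h3 (norm_nonneg D)
  have h6 := mul_lt_mul_of_pos_right h h4
  linarith [h5, h6, mul_assoc ‖D‖ (n : ℝ) (∑ i, ‖v i‖ ^ 2), mul_comm ‖D‖ (n : ℝ)]

/-- Positive definiteness is an open condition among the Hermitian matrices. -/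
theorem exists_posDef_of_norm_sub_lt {Λ₀ : Matrix (Fin n) (Fin n) ℂ} (h₀ : Λ₀.PosDef) :
    ∃ δ : ℝ, 0 < δ ∧ ∀ Λ : Matrix (Fin n) (Fin n) ℂ, Λ.IsHermitian → ‖Λ - Λ₀‖ < δ →
      Λ.PosDef := by
  set S := CFC.sqrt Λ₀ with hS
  have hSS : S * S = Λ₀ := sqrt_mul_sqrt_of_posDef h₀
  have hSp : S.PosDef := posDef_sqrt h₀
  have hSd : IsUnit S.det := (isUnit_iff_isUnit_det S).1 hSp.isUnit
  have hSi : (S⁻¹).IsHermitian := hSp.inv.isHermitian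
  refine ⟨1 / (n * (‖S⁻¹‖ * ‖S⁻¹‖) + 1), by positivity, fun Λ hΛ hlt => ?_⟩
  set D := S⁻¹ * (Λ - Λ₀) * S⁻¹ with hD
  have hDh : D.IsHermitian := by
    have := isHermitian_mul_mul_conjTranspose S⁻¹ (hΛ.sub h₀.isHermitian)
    rwa [hSi.eq] at this
  have hDn : n * ‖D‖ < 1 := by
    rw [lt_div_iff₀ (by positivity)] at hlt
    have h1 : ‖D‖ ≤ ‖S⁻¹‖ * ‖Λ - Λ₀‖ * ‖S⁻¹‖ :=
      (norm_mul_le _ _).trans (mul_le_mul_of_nonneg_right (norm_mul_le _ _) (norm_nonneg _))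
    calc n * ‖D‖ ≤ n * (‖S⁻¹‖ * ‖Λ - Λ₀‖ * ‖S⁻¹‖) := by gcongr
      _ ≤ ‖Λ - Λ₀‖ * (n * (‖S⁻¹‖ * ‖S⁻¹‖) + 1) := by nlinarith [norm_nonneg (Λ - Λ₀)]
      _ < 1 := hlt
  have hpd := posDef_one_add_of_norm_lt hDh hDn
  -- Congruence by `S` reduces the claim to a perturbation of the identity.
  have hΛeq : Λ = S * (1 + D) * star S := by
    have h1 : S * D * S = Λ - Λ₀ := by
      rw [hD, ← Matrix.mul_assoc, ← Matrix.mul_assoc, mul_nonsing_inv _ hSd, Matrix.one_mul,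
        Matrix.mul_assoc, nonsing_inv_mul _ hSd, Matrix.mul_one]
    rw [star_eq_conjTranspose, hSp.isHermitian.eq, Matrix.mul_add, Matrix.add_mul, h1,
      Matrix.mul_one, hSS]
    abel
  rw [hΛeq]
  exact (Matrix.IsUnit.posDef_star_right_conjugate_iff hSp.isUnit).2 hpd

/-- The square root is Lipschitz at a positive definite matrix. -/
theorem exists_norm_sqrt_sub_sqrt_le {Λ₀ : Matrix (Fin n) (Fin n) ℂ} (h₀ : Λ₀.PosDef) :
    ∃ C : ℝ, 0 < C ∧ ∀ Λ : Matrix (Fin n) (Fin n) ℂ, Λ.PosDef →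
      ‖CFC.sqrt Λ - CFC.sqrt Λ₀‖ ≤ C * ‖Λ - Λ₀‖ := by
  set S := CFC.sqrt Λ₀ with hS
  have hSS : S * S = Λ₀ := sqrt_mul_sqrt_of_posDef h₀
  have hSp : S.PosDef := posDef_sqrt h₀
  set K := CFC.sqrt S with hK
  have hKK : K * K = S := sqrt_mul_sqrt_of_posDef hSp
  have hKp : K.PosDef := posDef_sqrt hSp
  have hKd : IsUnit K.det := (isUnit_iff_isUnit_det K).1 hKp.isUnit
  refine ⟨n * ‖K⁻¹‖ ^ 2 + 1, by positivity, fun Λ hΛ => ?_⟩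
  set T := CFC.sqrt Λ with hT
  have hTT : T * T = Λ := sqrt_mul_sqrt_of_posDef hΛ
  have hTp : T.PosDef := posDef_sqrt hΛ
  set D := T - S with hD
  have hDh : Dᴴ = D := (hTp.isHermitian.sub hSp.isHermitian).eq
  -- This is D(T² - S²) = DTD + D²S. The first trace on the right is nonnegative and the second is
  -- ‖DK‖², which dominates ‖D‖² up to the constant ‖K⁻¹‖².
  have h1 : D * (Λ - Λ₀) = Dᴴ * T * D + D * D * (K * K) := by
    rw [← hTT, ← hSS, hKK, hDh, hD]
    noncomm_ring
  have h2 : (D * D * (K * K)).trace = ((‖D * K‖ ^ 2 : ℝ) : ℂ) := by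
    rw [← trace_conjTranspose_mul_self, conjTranspose_mul, hDh, hKp.isHermitian.eq,
      ← Matrix.mul_assoc, trace_mul_comm]
    simp only [Matrix.mul_assoc]
  have h3 : 0 ≤ ((Dᴴ * T * D).trace).re :=
    (Complex.nonneg_iff.1 (hTp.posSemidef.conjTranspose_mul_mul_same D).trace_nonneg).1
  have h4 : ‖D * K‖ ^ 2 ≤ n * (‖D‖ * ‖Λ - Λ₀‖) := by
    have h5 := congrArg (fun M => (Matrix.trace M).re) h1
    simp only [trace_add, Complex.add_re] at h5
    rw [h2, Complex.ofReal_re] at h5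
    have h6 := (Complex.re_le_norm _).trans (norm_trace_le (D * (Λ - Λ₀)))
    have h7 : n * ‖D * (Λ - Λ₀)‖ ≤ n * (‖D‖ * ‖Λ - Λ₀‖) := by gcongr; exact norm_mul_le _ _
    linarith
  have h8 : ‖D‖ ≤ ‖D * K‖ * ‖K⁻¹‖ := by
    have := norm_mul_le (D * K) K⁻¹
    rwa [Matrix.mul_assoc, mul_nonsing_inv _ hKd, Matrix.mul_one] at this
  have h9 : ‖D‖ * ‖D‖ ≤ ‖D‖ * (n * ‖K⁻¹‖ ^ 2 * ‖Λ - Λ₀‖) := by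
    calc ‖D‖ * ‖D‖ ≤ (‖D * K‖ * ‖K⁻¹‖) * (‖D * K‖ * ‖K⁻¹‖) := by gcongr
      _ = ‖D * K‖ ^ 2 * ‖K⁻¹‖ ^ 2 := by ring
      _ ≤ n * (‖D‖ * ‖Λ - Λ₀‖) * ‖K⁻¹‖ ^ 2 := by gcongr
      _ = _ := by ring
  rcases (norm_nonneg D).eq_or_lt with h0 | h0
  · rw [← h0]; positivity
  · have := le_of_mul_le_mul_left h9 h0
    nlinarith [norm_nonneg (Λ - Λ₀)]

/-! ### The linearized operator and its spectrum -/

theorem continuous_ofReal_mul_quadForm (hA : IsStabilityMatrix A) (r : C(Circle, ℝ))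
    (X : Matrix (Fin n) (Fin n) ℂ) : Continuous fun z => (r z : ℂ) * quadForm A B X z :=
  (Complex.continuous_ofReal.comp r.continuous).mul (continuous_quadForm hA X)

/-- The linear map `X ↦ S (∫ G r (G* X G) G*) S`. -/
noncomputable def momentOp (hA : IsStabilityMatrix A) (B : Fin n → ℂ)
    (S : Matrix (Fin n) (Fin n) ℂ) (r : C(Circle, ℝ)) :
    Matrix (Fin n) (Fin n) ℂ →ₗ[ℂ] Matrix (Fin n) (Fin n) ℂ where
  toFun X := S * moment A B (fun z => r z * quadForm A B X z) * S
  map_add' X Y := by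
    simp only [quadForm_add, mul_add]
    rw [moment_add hA (continuous_ofReal_mul_quadForm hA r X)
      (continuous_ofReal_mul_quadForm hA r Y), Matrix.mul_add, Matrix.add_mul]
  map_smul' c X := by
    simp only [quadForm_smul, mul_left_comm _ c]
    rw [moment_const_mul, Matrix.mul_smul, Matrix.smul_mul, RingHom.id_apply]

theorem momentOp_apply (hA : IsStabilityMatrix A) (S : Matrix (Fin n) (Fin n) ℂ) (r : C(Circle, ℝ))
    (X : Matrix (Fin n) (Fin n) ℂ) :
    momentOp hA B S r X = S * moment A B (fun z => r z * quadForm A B X z) * S := rfl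

theorem trace_conjTranspose_mul_moment (hA : IsStabilityMatrix A) (r : C(Circle, ℝ))
    (X : Matrix (Fin n) (Fin n) ℂ) :
    (Xᴴ * moment A B fun z => r z * quadForm A B X z).trace =
      avg fun z => ((r z * ‖quadForm A B X z‖ ^ 2 : ℝ) : ℂ) := by
  rw [trace_mul_moment hA _ (continuous_ofReal_mul_quadForm hA r X)]
  congr 1
  ext z
  rw [quadForm_conjTranspose, mul_assoc, Complex.star_def, Complex.mul_conj']
  push_cast
  rfl

/-- Pairing the moment with `Xᴴ` gives the mean of r|G*XG|², which vanishes only if G*XG does. -/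
theorem quadForm_eq_zero_of_momentOp_eq_zero (hA : IsStabilityMatrix A)
    {S : Matrix (Fin n) (Fin n) ℂ} (hS : IsUnit S) {r : C(Circle, ℝ)} (hr : ∀ z, 0 < r z)
    {X : Matrix (Fin n) (Fin n) ℂ} (h : momentOp hA B S r X = 0) (z : Circle) :
    quadForm A B X z = 0 := by
  rw [momentOp_apply, hS.mul_left_eq_zero, hS.mul_right_eq_zero] at h
  have h1 := trace_conjTranspose_mul_moment (B := B) hA r X
  rw [h, Matrix.mul_zero, trace_zero] at h1
  have h2 := eq_zero_of_avg_eq_zero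
    (r.continuous.mul ((continuous_quadForm hA X).norm.pow 2))
    (fun z => mul_nonneg (hr z).le (pow_nonneg (norm_nonneg _) 2)) h1.symm z
  simpa [(hr z).ne'] using h2

theorem trace_mul_vecMulVec_transfer (X : Matrix (Fin n) (Fin n) ℂ) (z : Circle) :
    (X * vecMulVec (transfer A B z) (star (transfer A B z))).trace = quadForm A B X z := by
  rw [quadForm_eq_sum, trace]
  refine Finset.sum_congr rfl fun i _ => ?_
  rw [diag_apply, mul_apply]
  rfl

/-- Eigenvalues of `momentOp` at a solution of the dual conditions are at most one, since it is a
positive map that fixes this solution. -/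
theorem eigenvalue_momentOp_le_one (hA : IsStabilityMatrix A) {S : Matrix (Fin n) (Fin n) ℂ}
    (hS : S.IsHermitian) {p q : C(Circle, ℝ)} (hp : ∀ z, 0 < p z) (hq : ∀ z, 0 < q z)
    (hSq : ∀ z, quadForm A B (S * S) z = q z)
    (hM : moment A B (fun z => ((p z / q z : ℝ) : ℂ)) = 1) {r : C(Circle, ℝ)}
    (hr : ∀ z, r z = p z / (q z * q z)) {X : Matrix (Fin n) (Fin n) ℂ} (hX : X ≠ 0) {μ : ℝ}
    (h : momentOp hA B S r X = (μ : ℂ) • X) : μ ≤ 1 := by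
  have hc : Continuous fun z => ‖quadForm A B X z‖ / q z :=
    (continuous_quadForm hA X).norm.div q.continuous fun z => (hq z).ne'
  -- Maximum principle: the eigenvalue equation is tested at a maximum point of |G*XG|/q.
  obtain ⟨z₀, -, hz₀⟩ := isCompact_univ.exists_isMaxOn Set.univ_nonempty hc.continuousOn
  replace hz₀ : ∀ z, ‖quadForm A B X z‖ / q z ≤ ‖quadForm A B X z₀‖ / q z₀ :=
    fun z => hz₀ (Set.mem_univ z)
  set c := ‖quadForm A B X z₀‖ / q z₀ with hcdef
  -- Pairing with `Y = S V S` evaluates the quadratic form of `S M S` at `z₀`. As `Y` is positive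
  -- semidefinite, G*YG is a nonnegative kernel.
  set V := vecMulVec (transfer A B z₀) (star (transfer A B z₀)) with hV
  set Y := S * V * S with hY
  have hYp : Y.PosSemidef := by
    have := (posSemidef_vecMulVec_self_star (transfer A B z₀)).mul_mul_conjTranspose_same S
    rwa [hS.eq] at this
  have hYz : ∀ z, 0 ≤ (quadForm A B Y z).re ∧ ((quadForm A B Y z).re : ℂ) = quadForm A B Y z :=
    fun z => ⟨(Complex.nonneg_iff.1 (hYp.dotProduct_mulVec_nonneg _)).1,
      quadForm_im_of_isHermitian hYp.isHermitian z⟩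
  have htr : ∀ M : Matrix (Fin n) (Fin n) ℂ, (Y * M).trace = quadForm A B (S * M * S) z₀ := by
    intro M
    rw [← trace_mul_vecMulVec_transfer, ← hV, hY, trace_mul_comm, ← Matrix.mul_assoc,
      ← Matrix.mul_assoc, trace_mul_comm]
    simp only [Matrix.mul_assoc]
  have hpq : Continuous fun z => p z / q z :=
    p.continuous.div q.continuous fun z => (hq z).ne'
  have hYc : Continuous fun z => (quadForm A B Y z).re :=
    Complex.continuous_re.comp (continuous_quadForm hA Y)
  -- The dual condition gives the kernel its total mass: the operator fixes `S * S`, whose quadratic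
  -- form is q.
  have h1 : avg (fun z => ((p z / q z * (quadForm A B Y z).re : ℝ) : ℂ)) = q z₀ := by
    have := trace_mul_moment (B := B) hA Y (Complex.continuous_ofReal.comp hpq)
    simp only [Function.comp_def] at this
    rw [hM, htr, Matrix.mul_one, hSq] at this
    rw [this]
    congr 1
    ext z
    rw [Complex.ofReal_mul, (hYz z).2]
  have h2 : (μ : ℂ) * quadForm A B X z₀ =
      avg fun z => r z * quadForm A B X z * quadForm A B Y z := by
    rw [← trace_mul_moment hA Y (continuous_ofReal_mul_quadForm hA r X), htr, ← quadForm_smul, ← h,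
      momentOp_apply]
  have h3 : ‖(μ : ℂ) * quadForm A B X z₀‖ ≤ c * q z₀ := by
    rw [h2]
    have h4 := norm_avg_le_re (φ := fun z => r z * quadForm A B X z * quadForm A B Y z)
      (f := fun z => c * (p z / q z * (quadForm A B Y z).re))
      (continuous_const.mul (hpq.mul hYc)) (fun z => by
        rw [norm_mul, norm_mul, ← (hYz z).2, Complex.norm_real, Complex.norm_real,
          Real.norm_of_nonneg (hYz z).1, hr z,
          Real.norm_of_nonneg (div_nonneg (hp z).le (mul_pos (hq z) (hq z)).le), Complex.ofReal_re]
        have h5 := mul_le_mul_of_nonneg_right (hz₀ z)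
          (mul_nonneg (div_pos (hp z) (hq z)).le (hYz z).1)
        refine le_trans (le_of_eq ?_) h5
        have := (hq z).ne'
        field_simp)
    refine h4.trans (le_of_eq ?_)
    have h6 : (avg fun z => ((c * (p z / q z * (quadForm A B Y z).re) : ℝ) : ℂ)) = c * q z₀ := by
      rw [← h1, ← avg_const_mul]
      congr 1
      ext z
      push_cast
      rfl
    rw [h6, ← Complex.ofReal_mul, Complex.ofReal_re]
  have h7 : c * q z₀ = ‖quadForm A B X z₀‖ := div_mul_cancel₀ _ (hq z₀).ne'
  rw [h7, norm_mul, Complex.norm_real] at h3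
  -- If the maximum is 0, then `X` lies in the kernel and μ = 0; otherwise the maximum cancels from
  -- |μ| max ≤ max.
  rcases (norm_nonneg (quadForm A B X z₀)).eq_or_lt with h0 | h0
  · have hzero : ∀ z, quadForm A B X z = 0 := by
      intro z
      have h8 := hz₀ z
      rw [hcdef, ← h0, zero_div] at h8
      have h9 : ‖quadForm A B X z‖ / q z = 0 := le_antisymm h8 (div_nonneg (norm_nonneg _) (hq z).le)
      simpa [(hq z).ne'] using h9
    have hP0 : momentOp hA B S r X = 0 := by
      rw [momentOp_apply]
      have : moment A B (fun z => (r z : ℂ) * quadForm A B X z) = 0 := by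
        ext i j
        simp [moment_apply, hzero, avg]
      rw [this, Matrix.mul_zero, Matrix.zero_mul]
    rw [hP0] at h
    have : (μ : ℂ) = 0 := (smul_eq_zero.1 h.symm).resolve_right hX
    have : μ = 0 := by exact_mod_cast this
    linarith
  · have h8 : ‖μ‖ ≤ 1 := le_of_mul_le_mul_right (by linarith) h0
    exact (le_abs_self μ).trans h8

/-- The isomorphism `X ↦ K⁻¹ X K⁻¹` onto a Euclidean space. -/
noncomputable def conjEquiv {K : Matrix (Fin n) (Fin n) ℂ} (hK : IsUnit K.det) :
    Matrix (Fin n) (Fin n) ℂ ≃ₗ[ℂ] EuclideanSpace ℂ (Fin n × Fin n) where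
  toFun X := WithLp.toLp 2 fun ij => (K⁻¹ * X * K⁻¹) ij.1 ij.2
  map_add' X Y := by
    ext ij
    simp [Matrix.mul_add, Matrix.add_mul]
  map_smul' c X := by
    ext ij
    simp
  invFun v := K * Matrix.of (fun i j => v (i, j)) * K
  left_inv X := by
    change K * (K⁻¹ * X * K⁻¹) * K = X
    rw [← Matrix.mul_assoc, ← Matrix.mul_assoc, mul_nonsing_inv _ hK, Matrix.one_mul,
      Matrix.mul_assoc, nonsing_inv_mul _ hK, Matrix.mul_one]
  right_inv v := by
    ext ij
    change (K⁻¹ * (K * Matrix.of (fun i j => v (i, j)) * K) * K⁻¹) ij.1 ij.2 = v ij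
    rw [← Matrix.mul_assoc, ← Matrix.mul_assoc, nonsing_inv_mul _ hK, Matrix.one_mul,
      Matrix.mul_assoc, mul_nonsing_inv _ hK, Matrix.mul_one]
    rfl

/-- With K² = S, the two factors `S` of `momentOp` cancel against the weights of the inner product,
leaving a plain trace pairing. Hence the symmetry of the operator. -/
theorem inner_conjEquiv_mul_mul {K : Matrix (Fin n) (Fin n) ℂ} (hK : IsUnit K.det)
    (hKh : K.IsHermitian) (X M : Matrix (Fin n) (Fin n) ℂ) :
    inner ℂ (conjEquiv hK X) (conjEquiv hK (K * K * M * (K * K))) = (Xᴴ * M).trace := by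
  have h1 : K⁻¹ * (K * K * M * (K * K)) * K⁻¹ = K * M * K := by
    simp only [← Matrix.mul_assoc]
    rw [nonsing_inv_mul _ hK, Matrix.one_mul]
    rw [Matrix.mul_assoc (K * M * K), mul_nonsing_inv _ hK, Matrix.mul_one]
  have h2 : inner ℂ (conjEquiv hK X) (conjEquiv hK (K * K * M * (K * K))) =
      ((K⁻¹ * X * K⁻¹)ᴴ * (K⁻¹ * (K * K * M * (K * K)) * K⁻¹)).trace := by
    rw [PiLp.inner_apply, Fintype.sum_prod_type, Finset.sum_comm, trace]
    refine Finset.sum_congr rfl fun i _ => ?_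
    rw [diag_apply, mul_apply]
    refine Finset.sum_congr rfl fun j _ => ?_
    rw [conjTranspose_apply]
    simp [conjEquiv, mul_comm]
  rw [h2, h1, conjTranspose_mul, conjTranspose_mul, hKh.inv.eq, ← Matrix.mul_assoc,
    ← Matrix.mul_assoc, trace_mul_comm]
  simp only [← Matrix.mul_assoc]
  rw [mul_nonsing_inv _ hK, Matrix.one_mul, Matrix.mul_assoc Xᴴ, nonsing_inv_mul _ hK,
    Matrix.mul_one]

/-! ### The affine space of dual solutions -/

/-- The real part of `G* Λ G` as a continuous function on the circle. -/
noncomputable def quadFormRe (hA : IsStabilityMatrix A) (B : Fin n → ℂ)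
    (Λ : Matrix (Fin n) (Fin n) ℂ) : C(Circle, ℝ) where
  toFun z := (quadForm A B Λ z).re
  continuous_toFun := Complex.continuous_re.comp (continuous_quadForm hA Λ)

theorem quadFormRe_apply (hA : IsStabilityMatrix A) (Λ : Matrix (Fin n) (Fin n) ℂ) (z : Circle) :
    quadFormRe hA B Λ z = (quadForm A B Λ z).re := rfl

theorem ofReal_quadFormRe (hA : IsStabilityMatrix A) {Λ : Matrix (Fin n) (Fin n) ℂ}
    (hΛ : Λ.IsHermitian) (z : Circle) : (quadFormRe hA B Λ z : ℂ) = quadForm A B Λ z :=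
  quadForm_im_of_isHermitian hΛ z

theorem quadFormRe_sub (hA : IsStabilityMatrix A) (X Y : Matrix (Fin n) (Fin n) ℂ) (z : Circle) :
    quadFormRe hA B (X - Y) z = quadFormRe hA B X z - quadFormRe hA B Y z := by
  simp only [quadFormRe_apply, quadForm_sub, Complex.sub_re]

theorem abs_quadFormRe_le (hA : IsStabilityMatrix A) (X : Matrix (Fin n) (Fin n) ℂ) (z : Circle) :
    |quadFormRe hA B X z| ≤ ‖quadForm A B X z‖ := Complex.abs_re_le_norm _

theorem mem_rangeGamPerp_iff (hA : IsStabilityMatrix A) {X : Matrix (Fin n) (Fin n) ℂ} :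
    X ∈ rangeGamPerp A B ↔ X.IsHermitian ∧ ∀ z, quadForm A B X z = 0 := by
  refine and_congr_right fun hX => ?_
  have htr : ∀ Φ : C(Circle, ℝ), (X * Gam A B Φ).trace =
      avg fun z => (Φ z : ℂ) * quadForm A B X z := fun Φ =>
    trace_mul_moment hA X (Complex.continuous_ofReal.comp Φ.continuous)
  constructor
  · intro h z
    -- The test function Φ = G*XG turns orthogonality into the vanishing of the mean of (G*XG)².
    have h1 := h (quadFormRe hA B X)
    rw [htr] at h1
    have h2 := eq_zero_of_avg_eq_zero (f := fun z => quadFormRe hA B X z * quadFormRe hA B X z)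
      ((quadFormRe hA B X).continuous.mul (quadFormRe hA B X).continuous)
      (fun z => mul_self_nonneg _) (by
        rw [← h1]
        congr 1
        ext z
        rw [Complex.ofReal_mul, ofReal_quadFormRe hA hX]) z
    rw [← ofReal_quadFormRe hA hX, mul_self_eq_zero.1 h2, Complex.ofReal_zero]
  · intro h Φ
    rw [htr]
    simp [h, avg]

/-- Two solutions have equal moments; pairing the difference with `Λ - Λ₀` gives the mean of Ψ(a -
b)²/(ab), so a = b. Conversely, the dual conditions depend on `Λ` only through G*ΛG. -/
theorem dualSolutions_eq (hA : IsStabilityMatrix A) {Ψ : C(Circle, ℝ)} (hΨ : ∀ z, 0 < Ψ z)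
    {Λ₀ : Matrix (Fin n) (Fin n) ℂ} (h₀ : Λ₀ ∈ dualSolutions A B Ψ) :
    dualSolutions A B Ψ = {Λ | ∃ X ∈ rangeGamPerp A B, Λ = Λ₀ + X} := by
  obtain ⟨hh₀, hq₀, hm₀⟩ := h₀
  ext Λ
  constructor
  · rintro ⟨hh, hq, hm⟩
    refine ⟨Λ - Λ₀, (mem_rangeGamPerp_iff hA).2 ⟨hh.sub hh₀, fun z => ?_⟩, by abel⟩
    set a := quadFormRe hA B Λ with ha
    set b := quadFormRe hA B Λ₀ with hb
    have ha' : ∀ z, (a z : ℂ) = quadForm A B Λ z := ofReal_quadFormRe hA hh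
    have hb' : ∀ z, (b z : ℂ) = quadForm A B Λ₀ z := ofReal_quadFormRe hA hh₀
    have hapos : ∀ z, 0 < a z := fun z => (Complex.pos_iff.1 (hq z)).1
    have hbpos : ∀ z, 0 < b z := fun z => (Complex.pos_iff.1 (hq₀ z)).1
    simp only [← ha'] at hm
    simp only [← hb'] at hm₀
    have hΨc : Continuous fun z => (Ψ z : ℂ) := Complex.continuous_ofReal.comp Ψ.continuous
    have hac : Continuous fun z => (a z : ℂ) := Complex.continuous_ofReal.comp a.continuous
    have hbc : Continuous fun z => (b z : ℂ) := Complex.continuous_ofReal.comp b.continuous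
    have hac' : Continuous fun z => (Ψ z : ℂ) / a z :=
      hΨc.div hac fun z => Complex.ofReal_ne_zero.2 (hapos z).ne'
    have hbc' : Continuous fun z => (Ψ z : ℂ) / b z :=
      hΨc.div hbc fun z => Complex.ofReal_ne_zero.2 (hbpos z).ne'
    have h1 := moment_sub (B := B) hA hbc' hac'
    rw [hm, hm₀, sub_self] at h1
    have h2 := trace_mul_moment (B := B) (φ := fun z => (Ψ z : ℂ) / b z - (Ψ z : ℂ) / a z) hA
      (Λ - Λ₀) (hbc'.sub hac')
    rw [h1, Matrix.mul_zero, trace_zero] at h2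
    have h3 := eq_zero_of_avg_eq_zero (f := fun z => Ψ z * (a z - b z) ^ 2 / (a z * b z))
      ((Ψ.continuous.mul ((a.continuous.sub b.continuous).pow 2)).div
        (a.continuous.mul b.continuous) fun z => (mul_pos (hapos z) (hbpos z)).ne')
      (fun z => by have := hΨ z; have := hapos z; have := hbpos z; positivity) (by
        rw [h2]
        congr 1
        ext z
        have := (hapos z).ne'
        have := (hbpos z).ne'
        rw [quadForm_sub, ← ha', ← hb']
        push_cast
        field_simp) z
    have h4 : a z - b z = 0 := by
      rw [div_eq_zero_iff, or_iff_left (mul_pos (hapos z) (hbpos z)).ne', mul_eq_zero,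
        or_iff_right (hΨ z).ne'] at h3
      exact pow_eq_zero_iff two_ne_zero |>.1 h3
    rw [quadForm_sub, ← ha', ← hb', ← Complex.ofReal_sub, h4, Complex.ofReal_zero]
  · rintro ⟨X, hX, rfl⟩
    obtain ⟨hXh, hX0⟩ := (mem_rangeGamPerp_iff hA).1 hX
    have : ∀ z, quadForm A B (Λ₀ + X) z = quadForm A B Λ₀ z := fun z => by
      rw [quadForm_add, hX0, add_zero]
    refine ⟨hh₀.add hXh, fun z => by rw [this]; exact hq₀ z, ?_⟩
    simp only [this]
    exact hm₀

/-! ### Exact expansion of Θ and Lipschitz estimates -/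

/-- The weight `Ψ / (a b)`. -/
noncomputable def weight (Ψ a b : C(Circle, ℝ)) (ha : ∀ z, 0 < a z) (hb : ∀ z, 0 < b z) :
    C(Circle, ℝ) where
  toFun z := Ψ z / (a z * b z)
  continuous_toFun := Ψ.continuous.div (a.continuous.mul b.continuous)
    fun z => (mul_pos (ha z) (hb z)).ne'

/-- Exact expression of `Θ` around a solution of the dual conditions. -/
theorem Theta_eq_sub_momentOp (hA : IsStabilityMatrix A) {Ψ : C(Circle, ℝ)}
    {Λ Λ₀ : Matrix (Fin n) (Fin n) ℂ} (hΛ : Λ.PosDef) (h₀ : Λ₀.IsHermitian)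
    (hm : moment A B (fun z => (Ψ z : ℂ) / quadForm A B Λ₀ z) = 1)
    (ha : ∀ z, 0 < quadFormRe hA B Λ z) (hb : ∀ z, 0 < quadFormRe hA B Λ₀ z) :
    Theta A B Ψ Λ = Λ - momentOp hA B (CFC.sqrt Λ)
      (weight Ψ (quadFormRe hA B Λ) (quadFormRe hA B Λ₀) ha hb) (Λ - Λ₀) := by
  have h1 : (fun z => (Ψ z : ℂ) / quadForm A B Λ z) = fun z => (Ψ z : ℂ) / quadForm A B Λ₀ z -
      weight Ψ (quadFormRe hA B Λ) (quadFormRe hA B Λ₀) ha hb z * quadForm A B (Λ - Λ₀) z := by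
    ext z
    have h2 : (quadFormRe hA B Λ z : ℂ) ≠ 0 := Complex.ofReal_ne_zero.2 (ha z).ne'
    have h3 : (quadFormRe hA B Λ₀ z : ℂ) ≠ 0 := Complex.ofReal_ne_zero.2 (hb z).ne'
    rw [quadForm_sub, ← ofReal_quadFormRe hA hΛ.isHermitian, ← ofReal_quadFormRe hA h₀]
    simp only [weight, ContinuousMap.coe_mk]
    push_cast
    field_simp
    ring
  have hc : Continuous fun z => (Ψ z : ℂ) / quadForm A B Λ₀ z := by
    simp only [← ofReal_quadFormRe hA h₀]
    exact (Complex.continuous_ofReal.comp Ψ.continuous).div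
      (Complex.continuous_ofReal.comp (quadFormRe hA B Λ₀).continuous)
      fun z => Complex.ofReal_ne_zero.2 (hb z).ne'
  rw [Theta, h1, moment_sub hA hc (continuous_ofReal_mul_quadForm hA _ _), hm, Matrix.mul_sub,
    Matrix.sub_mul, Matrix.mul_one, sqrt_mul_sqrt_of_posDef hΛ, momentOp_apply]

theorem Theta_isHermitian (Ψ : C(Circle, ℝ)) {Λ : Matrix (Fin n) (Fin n) ℂ} (hΛ : Λ.PosDef) :
    (Theta A B Ψ Λ).IsHermitian := by
  have h1 : (moment A B fun z => (Ψ z : ℂ) / quadForm A B Λ z).IsHermitian := by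
    rw [IsHermitian, moment_conjTranspose]
    congr 1
    ext z
    rw [← quadForm_im_of_isHermitian hΛ.isHermitian, ← Complex.ofReal_div, Complex.star_def,
      Complex.conj_ofReal]
  have := isHermitian_mul_mul_conjTranspose (CFC.sqrt Λ) h1
  rwa [(posDef_sqrt hΛ).isHermitian.eq] at this

theorem exists_forall_quadFormRe_pos (hA : IsStabilityMatrix A) {Λ₀ : Matrix (Fin n) (Fin n) ℂ}
    (hb : ∀ z, 0 < quadFormRe hA B Λ₀ z) :
    ∃ δ m : ℝ, 0 < δ ∧ 0 < m ∧ ∀ Λ, ‖Λ - Λ₀‖ < δ → ∀ z, m ≤ quadFormRe hA B Λ z := by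
  obtain ⟨z₀, -, hz₀⟩ := isCompact_univ.exists_isMinOn Set.univ_nonempty
    (quadFormRe hA B Λ₀).continuous.continuousOn
  obtain ⟨C, hC, hq⟩ := exists_norm_quadForm_le hA B
  set m := quadFormRe hA B Λ₀ z₀ with hm
  have hm0 : 0 < m := hb z₀
  refine ⟨m / (2 * C), m / 2, by positivity, by positivity, fun Λ hΛ z => ?_⟩
  have h1 : m ≤ quadFormRe hA B Λ₀ z := hz₀ (Set.mem_univ z)
  have h2 := (abs_le.1 ((abs_quadFormRe_le hA (Λ - Λ₀) z).trans (hq _ z))).1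
  rw [quadFormRe_sub] at h2
  rw [lt_div_iff₀ (by positivity)] at hΛ
  linarith

theorem exists_abs_le (Ψ : C(Circle, ℝ)) : ∃ c : ℝ, 0 < c ∧ ∀ z, |Ψ z| ≤ c := by
  obtain ⟨c, hc⟩ := (isCompact_range Ψ.continuous.abs).bddAbove
  exact ⟨max c 1, by positivity, fun z => (hc ⟨z, rfl⟩).trans (le_max_left _ _)⟩

theorem abs_weight_le {Ψ a b : C(Circle, ℝ)} (ha : ∀ z, 0 < a z) (hb : ∀ z, 0 < b z)
    {c m : ℝ} (hc : ∀ z, |Ψ z| ≤ c) (hm : 0 < m) (hma : ∀ z, m ≤ a z) (hmb : ∀ z, m ≤ b z)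
    (z : Circle) : |weight Ψ a b ha hb z| ≤ c / m ^ 2 := by
  simp only [weight, ContinuousMap.coe_mk]
  rw [abs_div, abs_of_pos (mul_pos (ha z) (hb z)), sq]
  exact div_le_div₀ ((abs_nonneg _).trans (hc z)) (hc z) (by positivity)
    (mul_le_mul (hma z) (hmb z) hm.le (ha z).le)

/-- The difference is Ψ(a - b)/(ab²), and each factor of the denominator is at least m. -/
theorem abs_weight_sub_weight_le {Ψ a b : C(Circle, ℝ)} (ha : ∀ z, 0 < a z) (hb : ∀ z, 0 < b z)
    {c m d : ℝ} (hc : ∀ z, |Ψ z| ≤ c) (hm : 0 < m) (hma : ∀ z, m ≤ a z) (hmb : ∀ z, m ≤ b z)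
    (z : Circle) (hd : |a z - b z| ≤ d) :
    |weight Ψ b b hb hb z - weight Ψ a b ha hb z| ≤ c * d / m ^ 3 := by
  have h1 := ha z
  have h2 := hb z
  have hc0 : 0 ≤ c := (abs_nonneg _).trans (hc z)
  have hd0 : 0 ≤ d := (abs_nonneg _).trans hd
  have h3 : weight Ψ b b hb hb z - weight Ψ a b ha hb z =
      Ψ z * (a z - b z) / (a z * b z * b z) := by
    simp only [weight, ContinuousMap.coe_mk]
    field_simp
  rw [h3, abs_div, abs_mul, abs_of_pos (mul_pos (mul_pos h1 h2) h2)]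
  refine div_le_div₀ (by positivity) (mul_le_mul (hc z) hd (abs_nonneg _) hc0) (by positivity) ?_
  refine le_trans (le_of_eq ?_) (mul_le_mul (mul_le_mul (hma z) (hmb z) hm.le h1.le) (hmb z) hm.le
    (mul_pos h1 h2).le)
  ring

/-- Bounds of the integrals in the expression of `Θ`, and their Lipschitz dependence on the base
point. -/
theorem exists_norm_moment_weight_le (hA : IsStabilityMatrix A) (Ψ : C(Circle, ℝ))
    {Λ₀ : Matrix (Fin n) (Fin n) ℂ} (hb : ∀ z, 0 < quadFormRe hA B Λ₀ z) :
    ∃ δ K₁ K₂ : ℝ, 0 < δ ∧ 0 < K₁ ∧ 0 < K₂ ∧ ∀ Λ : Matrix (Fin n) (Fin n) ℂ, ‖Λ - Λ₀‖ < δ →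
      ∃ ha : ∀ z, 0 < quadFormRe hA B Λ z, ∀ Z : Matrix (Fin n) (Fin n) ℂ,
        ‖moment A B fun z => (weight Ψ _ _ ha hb z : ℂ) * quadForm A B Z z‖ ≤ K₂ * ‖Z‖ ∧
        ‖(moment A B fun z => (weight Ψ _ _ hb hb z : ℂ) * quadForm A B Z z) -
          moment A B fun z => (weight Ψ _ _ ha hb z : ℂ) * quadForm A B Z z‖ ≤
            K₁ * ‖Λ - Λ₀‖ * ‖Z‖ := by
  obtain ⟨δ, m, hδ, hm, hq⟩ := exists_forall_quadFormRe_pos hA hb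
  obtain ⟨C₂, hC₂, hquad⟩ := exists_norm_quadForm_le hA B
  obtain ⟨C₃, hC₃, hmom⟩ := exists_norm_moment_le hA B
  obtain ⟨c, hc, hΨc⟩ := exists_abs_le Ψ
  refine ⟨δ, C₃ * (c * C₂ / m ^ 3 * C₂), C₃ * (c / m ^ 2 * C₂), hδ, by positivity, by positivity,
    fun Λ hlt => ?_⟩
  have hqa := hq Λ hlt
  have hqb := hq Λ₀ (by simpa using hδ)
  have ha : ∀ z, 0 < quadFormRe hA B Λ z := fun z => hm.trans_le (hqa z)
  refine ⟨ha, fun Z => ⟨?_, ?_⟩⟩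
  · refine (hmom _ (c / m ^ 2 * (C₂ * ‖Z‖)) fun z => ?_).trans (le_of_eq (by ring))
    rw [norm_mul, Complex.norm_real]
    exact mul_le_mul (abs_weight_le ha hb hΨc hm hqa hqb z) (hquad Z z) (norm_nonneg _)
      (by positivity)
  · rw [← moment_sub hA (continuous_ofReal_mul_quadForm hA _ _)
      (continuous_ofReal_mul_quadForm hA _ _)]
    refine (hmom _ (c * (C₂ * ‖Λ - Λ₀‖) / m ^ 3 * (C₂ * ‖Z‖)) fun z => ?_).trans
      (le_of_eq (by ring))
    rw [← sub_mul, norm_mul, ← Complex.ofReal_sub, Complex.norm_real]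
    refine mul_le_mul (abs_weight_sub_weight_le ha hb hΨc hm hqa hqb z ?_) (hquad Z z)
      (norm_nonneg _) (by positivity)
    rw [← quadFormRe_sub]
    exact (abs_quadFormRe_le hA _ z).trans (hquad _ z)

theorem norm_mul_mul_sub_mul_mul_le {R : Type*} [NormedRing R] (S T b a : R) :
    ‖S * b * S - T * a * T‖ ≤
      ‖S‖ * ‖b‖ * ‖S - T‖ + ‖S‖ * ‖b - a‖ * ‖T‖ + ‖S - T‖ * ‖a‖ * ‖T‖ := by
  have hsplit : S * b * S - T * a * T =
      S * b * (S - T) + S * (b - a) * T + (S - T) * a * T := by noncomm_ring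
  have hmul3 : ∀ X Y W : R, ‖X * Y * W‖ ≤ ‖X‖ * ‖Y‖ * ‖W‖ := fun X Y W =>
    (norm_mul_le _ _).trans (mul_le_mul_of_nonneg_right (norm_mul_le _ _) (norm_nonneg _))
  rw [hsplit]
  exact norm_add₃_le.trans (add_le_add (add_le_add (hmul3 _ _ _) (hmul3 _ _ _)) (hmul3 _ _ _))

theorem norm_mul_mul_sub_mul_mul_le_of_le {R : Type*} [NormedRing R] {S T b a : R}
    {C K₁ K₂ d t : ℝ} (hC : 0 ≤ C) (hK₁ : 0 ≤ K₁) (hK₂ : 0 ≤ K₂) (hd : 0 ≤ d) (hd1 : d ≤ 1)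
    (ht : 0 ≤ t) (hTS : ‖T - S‖ ≤ C * d) (hb : ‖b‖ ≤ K₂ * t) (ha : ‖a‖ ≤ K₂ * t)
    (hba : ‖b - a‖ ≤ K₁ * d * t) :
    ‖S * b * S - T * a * T‖ ≤
      (‖S‖ * K₂ * C + ‖S‖ * K₁ * (‖S‖ + C) + C * K₂ * (‖S‖ + C)) * d * t := by
  have hTn : ‖T‖ ≤ ‖S‖ + C := by
    have h1 := norm_sub_norm_le T S
    have h2 : C * d ≤ C * 1 := by gcongr
    linarith
  refine (norm_mul_mul_sub_mul_mul_le S T b a).trans ?_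
  rw [norm_sub_rev S T]
  calc _ ≤ ‖S‖ * (K₂ * t) * (C * d) + ‖S‖ * (K₁ * d * t) * (‖S‖ + C) +
        C * d * (K₂ * t) * (‖S‖ + C) := by gcongr
    _ = _ := by ring

/-- The operators in the expression of `Θ` depend in a Lipschitz way on the base point. -/
theorem exists_norm_momentOp_sub_momentOp_le (hA : IsStabilityMatrix A) (Ψ : C(Circle, ℝ))
    {Λ₀ : Matrix (Fin n) (Fin n) ℂ} (h₀ : Λ₀.PosDef) (hb : ∀ z, 0 < quadFormRe hA B Λ₀ z) :
    ∃ δ K : ℝ, 0 < δ ∧ 0 < K ∧ ∀ Λ : Matrix (Fin n) (Fin n) ℂ, Λ.IsHermitian → ‖Λ - Λ₀‖ < δ →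
      Λ.PosDef ∧ ∃ ha : ∀ z, 0 < quadFormRe hA B Λ z, ∀ Z : Matrix (Fin n) (Fin n) ℂ,
        ‖momentOp hA B (CFC.sqrt Λ₀) (weight Ψ _ _ hb hb) Z -
          momentOp hA B (CFC.sqrt Λ) (weight Ψ _ _ ha hb) Z‖ ≤ K * ‖Λ - Λ₀‖ * ‖Z‖ := by
  obtain ⟨δ₁, K₁, K₂, hδ₁, hK₁, hK₂, hmom⟩ := exists_norm_moment_weight_le hA Ψ hb
  obtain ⟨δ₂, hδ₂, hpd⟩ := exists_posDef_of_norm_sub_lt h₀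
  obtain ⟨C, hC, hsqrt⟩ := exists_norm_sqrt_sub_sqrt_le h₀
  set M := ‖CFC.sqrt Λ₀‖ * K₂ * C + ‖CFC.sqrt Λ₀‖ * K₁ * (‖CFC.sqrt Λ₀‖ + C) +
    C * K₂ * (‖CFC.sqrt Λ₀‖ + C) with hM
  refine ⟨min 1 (min δ₁ δ₂), M, by positivity, by positivity, fun Λ hΛ hlt => ?_⟩
  have hd1 : ‖Λ - Λ₀‖ ≤ 1 := hlt.le.trans (min_le_left _ _)
  have hlt1 : ‖Λ - Λ₀‖ < δ₁ := hlt.trans_le ((min_le_right _ _).trans (min_le_left _ _))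
  have hlt2 : ‖Λ - Λ₀‖ < δ₂ := hlt.trans_le ((min_le_right _ _).trans (min_le_right _ _))
  have hΛp := hpd Λ hΛ hlt2
  obtain ⟨ha, h⟩ := hmom Λ hlt1
  -- The case `Λ = Λ₀` bounds the moment at the base point.
  obtain ⟨_, h'⟩ := hmom Λ₀ (by simpa using hδ₁)
  exact ⟨hΛp, ha, fun Z => norm_mul_mul_sub_mul_mul_le_of_le hC.le hK₁.le hK₂.le (norm_nonneg _)
    hd1 (norm_nonneg _) (hsqrt Λ hΛp) (h' Z).1 (h Z).1 (h Z).2⟩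

end SpectralApprox

/-! ### Assembly of the theorem -/

theorem mainTheorem1 {n : ℕ} (A : Matrix (Fin n) (Fin n) ℂ) (B : Fin n → ℂ)
    (hA : SpectralApprox.IsStabilityMatrix A) (hAB : SpectralApprox.IsReachablePair A B)
    (Ψ : C(Circle, ℝ)) (hΨ : ∀ z, 0 < Ψ z)
    (Λ₀ : Matrix (Fin n) (Fin n) ℂ) (hΛ₀ : Λ₀ ∈ SpectralApprox.posDualSolutions A B Ψ) :
    -- the solutions of the dual conditions form an affine space
    SpectralApprox.dualSolutions A B Ψ =
        {Λ | ∃ X ∈ SpectralApprox.rangeGamPerp A B, Λ = Λ₀ + X} ∧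
    -- stability
    (∀ ε : ℝ, 0 < ε → ∃ δ : ℝ, 0 < δ ∧ ∀ Λ : ℕ → Matrix (Fin n) (Fin n) ℂ,
      SpectralApprox.IsTrajectoryNear A B Ψ Λ₀ δ Λ → ∀ k, ‖Λ k - Λ₀‖ < ε) ∧
    -- exponential convergence to a positive definite dual solution
    (∃ δ κ β : ℝ, 0 < δ ∧ 0 < κ ∧ 0 < β ∧ β < 1 ∧
      ∀ Λ : ℕ → Matrix (Fin n) (Fin n) ℂ,
        SpectralApprox.IsTrajectoryNear A B Ψ Λ₀ δ Λ →
          (∀ k, (Λ k).PosDef) ∧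
          ∃ Λlim ∈ SpectralApprox.posDualSolutions A B Ψ,
            ∀ k, ‖Λ k - Λlim‖ ≤ κ * β ^ k) := by
  open SpectralApprox Matrix in
  obtain ⟨hdual, hpos⟩ := hΛ₀
  have hdual_eq := dualSolutions_eq hA hΨ hdual
  refine ⟨hdual_eq, ?_⟩
  obtain ⟨hh₀, hq₀, hm₀⟩ := hdual
  have hb : ∀ z, 0 < quadFormRe hA B Λ₀ z := fun z => (Complex.pos_iff.1 (hq₀ z)).1
  set S := CFC.sqrt Λ₀ with hS
  have hSS : S * S = Λ₀ := sqrt_mul_sqrt_of_posDef hpos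
  have hSp : S.PosDef := posDef_sqrt hpos
  -- K = Λ₀^{1/4}: the isomorphism X ↦ K⁻¹XK⁻¹ makes `P` symmetric.
  set K := CFC.sqrt S with hK
  have hKK : K * K = S := sqrt_mul_sqrt_of_posDef hSp
  have hKp : K.PosDef := posDef_sqrt hSp
  have hKd : IsUnit K.det := (Matrix.isUnit_iff_isUnit_det K).1 hKp.isUnit
  set r := weight Ψ (quadFormRe hA B Λ₀) (quadFormRe hA B Λ₀) hb hb with hr
  have hrpos : ∀ z, 0 < r z := fun z => div_pos (hΨ z) (mul_pos (hb z) (hb z))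
  set P := momentOp hA B S r with hP
  have hinner : ∀ X Y, inner ℂ (conjEquiv hKd X) (conjEquiv hKd (P Y)) =
      avg fun z => r z * quadForm A B Y z * star (quadForm A B X z) := by
    intro X Y
    rw [hP, momentOp_apply, ← hKK, inner_conjEquiv_mul_mul hKd hKp.isHermitian,
      trace_mul_moment hA _ (continuous_ofReal_mul_quadForm hA r Y)]
    simp only [quadForm_conjTranspose]
  have hsym : ∀ X Y, inner ℂ (conjEquiv hKd (P X)) (conjEquiv hKd Y) =
      inner ℂ (conjEquiv hKd X) (conjEquiv hKd (P Y)) := by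
    intro X Y
    rw [← inner_conj_symm, hinner, hinner, ← Complex.star_def, ← avg_star]
    congr 1
    ext z
    simp only [star_mul', Complex.star_def, Complex.conj_ofReal, Complex.conj_conj]
    ring
  have hev : ∀ (μ : ℝ) (X : Matrix (Fin n) (Fin n) ℂ), X ≠ 0 → P X = (μ : ℂ) • X →
      0 ≤ μ ∧ μ ≤ 1 := by
    intro μ X hX h
    constructor
    · have h1 := hinner X X
      rw [h, map_smul, inner_smul_right, inner_self_eq_norm_sq_to_K] at h1
      have h2 : (fun z => (r z : ℂ) * quadForm A B X z * star (quadForm A B X z)) =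
          fun z => ((r z * ‖quadForm A B X z‖ ^ 2 : ℝ) : ℂ) := by
        ext z
        rw [mul_assoc, Complex.star_def, Complex.mul_conj']
        push_cast
        rfl
      rw [h2] at h1
      have h3 := avg_ofReal_nonneg (f := fun z => r z * ‖quadForm A B X z‖ ^ 2)
        fun z => mul_nonneg (hrpos z).le (by positivity)
      have h4 : 0 < ‖conjEquiv hKd X‖ ^ 2 := by
        have : conjEquiv hKd X ≠ 0 := by simpa using hX
        positivity
      have h5 : ((μ : ℂ) * ((‖conjEquiv hKd X‖ : ℝ) : ℂ) ^ 2).re = μ * ‖conjEquiv hKd X‖ ^ 2 := by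
        rw [← Complex.ofReal_pow, ← Complex.ofReal_mul, Complex.ofReal_re]
      rw [← h1] at h3
      exact nonneg_of_mul_nonneg_left (h3.trans (le_of_eq h5)) h4
    · refine eigenvalue_momentOp_le_one hA hSp.isHermitian hΨ hb (fun z => ?_) ?_ (fun z => rfl) hX h
      · rw [hSS, ofReal_quadFormRe hA hh₀]
      · rw [← hm₀]
        congr 1
        ext z
        rw [Complex.ofReal_div, ofReal_quadFormRe hA hh₀]
  obtain ⟨δ₁, C, hδ₁, hC, hest⟩ := exists_norm_momentOp_sub_momentOp_le hA Ψ hpos hb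
  have hker : ∀ X, P X = 0 → ∀ z, quadForm A B X z = 0 := fun X hX =>
    quadForm_eq_zero_of_momentOp_eq_zero hA hSp.isUnit hrpos hX
  -- Every operator of this form, not only `P`, kills ker `P`; this bounds the error by the distance
  -- to the kernel.
  have hker' : ∀ (T : Matrix (Fin n) (Fin n) ℂ) (ρ : C(Circle, ℝ)) X Y, P Y = 0 →
      momentOp hA B T ρ (X - Y) = momentOp hA B T ρ X := by
    intro T ρ X Y hY
    simp only [momentOp_apply, quadForm_sub, hker Y hY, sub_zero]
  obtain ⟨β, hβ0, hβ1, H⟩ := exp_convergence_of_conj (conjEquiv hKd) hsym hev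
    (Theta A B Ψ) Λ₀ {Λ | Λ.IsHermitian}
    (fun ε hε => by
      refine ⟨min δ₁ (ε / C), by positivity, fun Λ hΛ hlt Y hY => ?_⟩
      obtain ⟨hΛp, ha, h⟩ := hest Λ hΛ (hlt.trans_le (min_le_left _ _))
      have h1 : Theta A B Ψ Λ - Λ + P (Λ - Λ₀) =
          P (Λ - Λ₀ - Y) - momentOp hA B (CFC.sqrt Λ) (weight Ψ _ _ ha hb) (Λ - Λ₀ - Y) := by
        rw [Theta_eq_sub_momentOp hA hΛp hh₀ hm₀ ha hb, hker' S r _ _ hY,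
          hker' (CFC.sqrt Λ) _ _ _ hY]
        abel
      rw [h1]
      refine (h _).trans (mul_le_mul_of_nonneg_right ?_ (norm_nonneg _))
      have := hlt.le.trans (min_le_right _ _)
      rwa [le_div_iff₀' hC] at this)
    ⟨δ₁, hδ₁, fun Λ hΛ hlt => Theta_isHermitian Ψ (hest Λ hΛ hlt).1⟩
  constructor
  · intro ε hε
    obtain ⟨δ, κ, hδ, -, H⟩ := H ε hε
    exact ⟨δ, hδ, fun Λ ⟨h0, hlt, hk⟩ k => ((H Λ h0 hlt hk).1 k).2⟩
  -- The limit is only within the closed radius, so half of δ₁ keeps it strictly inside the ball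
  -- where Hermitian matrices are positive definite.
  · obtain ⟨δ, κ, hδ, hκ, H⟩ := H (δ₁ / 2) (by positivity)
    refine ⟨δ, κ, β, hδ, hκ, hβ0, hβ1, fun Λ ⟨h0, hlt, hk⟩ => ?_⟩
    obtain ⟨h1, l, hl1, hl2, hl3, hl4⟩ := H Λ h0 hlt hk
    have hlh : l.IsHermitian := by
      have hcl : IsClosed {X : Matrix (Fin n) (Fin n) ℂ | X.IsHermitian} :=
        isClosed_eq continuous_id.matrix_conjTranspose continuous_id
      exact hcl.mem_of_tendsto hl2 (Filter.Eventually.of_forall fun k => (h1 k).1)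
    refine ⟨fun k => (hest _ (h1 k).1 ((h1 k).2.trans (by linarith))).1, l, ⟨?_, ?_⟩, hl4⟩
    · rw [hdual_eq]
      exact ⟨l - Λ₀, (mem_rangeGamPerp_iff hA).2 ⟨hlh.sub hh₀, hker _ hl1⟩, by abel⟩
    · exact (hest l hlh (hl3.trans_lt (by linarith))).1
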